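/- **Setting.** Let $G$ be a (typically infinite) weighted bipartite planar graph, drawn in $\mathbb C$ with straight edges which meet only at common endpoints, in a locally finite way (every bounded set meets finitely many vertices and edges), with positive edge weights $w(e)$, such that $0$ lies on no edge. (The main example is the hexagonal lattice with $w\equiv 1$, i.e. lozenge tilings.) A *domain* $D$ is a finite set of vertices, identified with the induced subgraph; a *configuration* on $D$ is a perfect matching $M$ of it, and the *dimer measure* on $D$ gives $M$ a mass proportional to $\prod_{e\in M}w(e)$ (the uniform measure if $w\equiv1$). Domains are assumed to have at least one configuration. If $D$ is random, the dimer measure on $D$ is the law of $M$ when, given $D$, $M$ is sampled from the dimer measure on $D$. We say that $D$ *contains $0$* if the face of $G$ containing $0$ has a vertex in $D$. **Local convergence.** Configurations are seen as closed subsets of $\mathbb C$, with the distance $d(E,F)=\exp(-\max\{R: E\cap B(0,R)=F\cap B(0,R)\})$. Local convergence (around $0$) is convergence in law for $d$. **Heights.** Fix a reference flow $\omega$, i.e. real numbers $\omega(e)$ with $\sum_{e\ni v}\omega(e)=1$ for every vertex $v$. A *height function* of a configuration $M$ on $D$ is a function $h_M$ on the faces of $G$ such that, when one crosses an edge $e$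 with an endpoint in $D$ from the right to the left of its white-to-black orientation, $h_M$ changes by $\mathbf 1_{e\in M}-\omega(e)$. For a perfect matching of the whole graph (where $D$ is replaced by the set of all vertices) it is unique up to an additive constant. On a domain $D$ the additive constants are fixed on the boundary: every face having a vertex in $D$ is connected, by crossing edges with an endpoint in $D$, to a face of $\partial D$ at which $h_M$ does not depend on $M$. Here $\partial D$ is the set of faces of $G$ that have both a vertex in $D$ and a vertex outside $D$. **Spread-out property.** For $R>0$ and a perfect matching $m$ of $G$, let $\pi(R,m)$ be the dimer measure on the perfect matchings of $G$ that agree with $m$ outside $B(0,R)$. A probability measure $\mu$ on perfect matchings of $G$ is *spread-out* if for every $\varepsilon>0$ there is $R>0$ such that $$\mathbb P_\mu\Big[\forall x\in\mathbb R,\ \mathbb P_{\pi(R,M)}\big[h(0)\in(x,x+1)\big]\le\varepsilon\Big]>1-\varepsilon,$$ where $h(0)$ is the height of the face containing $0$, for the height function normalized by fixing its value at any point outside $B(0,R)$. **Theorem.** Let $\mu$ be a spread-out probability measure on perfect matchings of $G$, and let $(D_n)$, $(D'_n)$ be two sequences of (possibly random) domains containing $0$, defined on the same probability space. Assume that the dimer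 measures on $D_n$ converge locally around $0$ to $\mu$, and that there is a constant $K>0$ such that, for almost all realisations of $(D_n,D'_n)_n$, for every $n$ and all configurations $M$ on $D_n$ and $M'$ on $D'_n$, $$\sup_{v\in\partial(D_n\cap D'_n)}|h_{M'}(v)-h_M(v)|\le K,$$ for suitable normalized height functions on $D_n$ and on $D'_n$ (the additive constants may depend on the realisation and on $n$, but not on the configurations). Then the dimer measures on $D'_n$ also converge locally around $0$ to $\mu$. -/

import Mathlib

open Filter Topology MeasureTheory

/-- A weighted bipartite graph drawn in the plane: vertices are distinct points, edges are the
straight segments joining their endpoints, distinct edges meet only at common endpoints, no edge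
passes through a further vertex, and every bounded region meets only finitely many vertices and
edges. Every edge carries a positive weight. -/
structure PlaneBipartiteGraph (V : Type*) where
  graph : SimpleGraph V
  white : Set V
  bipartite : ∀ u v, graph.Adj u v → (u ∈ white ↔ v ∉ white)
  pos : V → ℂ
  pos_injective : Function.Injective pos
  noncrossing : ∀ u v u' v', graph.Adj u v → graph.Adj u' v' → s(u, v) ≠ s(u', v') →
    ∀ z ∈ segment ℝ (pos u) (pos v) ∩ segment ℝ (pos u') (pos v'),
      ∃ x, pos x = z ∧ x ∈ s(u, v) ∧ x ∈ s(u', v')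
  no_vertex_inside : ∀ u v x, graph.Adj u v → pos x ∈ segment ℝ (pos u) (pos v) → x ∈ s(u, v)
  finite_vertices : ∀ R : ℝ, {v | ‖pos v‖ ≤ R}.Finite
  finite_edges : ∀ R : ℝ, {e : graph.edgeSet | ∃ u v, e.1 = s(u, v) ∧
    (segment ℝ (pos u) (pos v) ∩ Metric.closedBall 0 R).Nonempty}.Finite
  weight : graph.edgeSet → ℝ
  weight_pos : ∀ e, 0 < weight e

namespace PlaneBipartiteGraph

variable {V : Type*} (G : PlaneBipartiteGraph V)

abbrev Edge : Type _ := G.graph.edgeSet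

/-- Edge configurations, with the product sigma-algebra. -/
abbrev Config : Type _ := Set G.Edge

/-- The closed segment that represents an edge. -/
def edgeSegment (e : G.Edge) : Set ℂ :=
  {z | ∃ u v, e.1 = s(u, v) ∧ z ∈ segment ℝ (G.pos u) (G.pos v)}

/-- A configuration seen as a closed subset of the plane. -/
def drawing (M : G.Config) : Set ℂ := ⋃ e ∈ M, G.edgeSegment e

/-- The union of all edges of the graph. -/
def skeleton : Set ℂ := G.drawing Set.univ

/-- The face containing the point `z` (empty when `z` lies on an edge). -/
def face (z : ℂ) : Set ℂ := connectedComponentIn G.skeletonᶜ z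

/-! ### Dimer configurations and dimer measures -/

/-- `M` is a dimer configuration (perfect matching) of the subgraph induced by `D`. -/
def IsDimer (D : Set V) (M : G.Config) : Prop :=
  (∀ e ∈ M, ∀ v ∈ e.1, v ∈ D) ∧ ∀ v ∈ D, ∃! e : G.Edge, e ∈ M ∧ v ∈ e.1

/-- The probability measure on a finite set `S` of configurations that gives `M ∈ S` a mass
proportional to `wt M`. -/
noncomputable def boltzmann (S : Set G.Config) (wt : G.Config → ℝ) : Measure G.Config :=
  (ENNReal.ofReal (∑ᶠ M ∈ S, wt M))⁻¹ •
    Measure.sum fun M : S => ENNReal.ofReal (wt M.1) • Measure.dirac M.1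

/-- The dimer measure on the finite domain `D`: the mass of a dimer configuration is proportional
to the product of the weights of its edges. -/
noncomputable def dimerMeasure (D : Finset V) : Measure G.Config :=
  G.boltzmann {M | G.IsDimer (D : Set V) M} fun M => ∏ᶠ e ∈ M, G.weight e

/-- The edges contained in the closed ball of radius `R` around the origin. -/
def edgesInside (R : ℝ) : Set G.Edge := {e | G.edgeSegment e ⊆ Metric.closedBall 0 R}

/-- The dimer measure on the dimer configurations of the whole graph that agree with `m` outside
the ball of radius `R` around the origin. The weights of the edges outside the ball are common to
all these configurations and cancel in the normalization. -/
noncomputable def specification (R : ℝ) (m : G.Config) : Measure G.Config :=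
  G.boltzmann
    {M | G.IsDimer Set.univ M ∧ ∀ e, e ∉ G.edgesInside R → (e ∈ M ↔ e ∈ m)}
    fun M => ∏ᶠ e ∈ M ∩ G.edgesInside R, G.weight e

/-- The law of a dimer configuration on a random domain `D`: the average of the dimer measures. -/
noncomputable def randomDimerLaw {Ω : Type*} [MeasurableSpace Ω] (P : Measure Ω)
    (D : Ω → Finset V) : Measure G.Config :=
  P.bind fun ω => G.dimerMeasure (D ω)

/-! ### Height functions -/

/-- A reference flow: a unit flow out of every white vertex and into every black vertex. -/
def IsReferenceFlow (ref : G.Edge → ℝ) : Prop :=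
  ∀ v : V, ∑ᶠ e ∈ {e : G.Edge | v ∈ e.1}, ref e = 1

/-- The face of `z` is the one on the left of the segment from `u` to `v`. The face on the right
of this segment is the one on the left of the segment from `v` to `u`. -/
def OnLeft (u v : V) (z : ℂ) : Prop :=
  z ∉ G.skeleton ∧ ∀ᶠ t : ℝ in 𝓝[>] 0,
    (G.pos u + G.pos v) / 2 + t * Complex.I * (G.pos v - G.pos u) ∈ G.face z

open Classical in
/-- `h` is a height function of the configuration `M` on the domain `D` (seen as a function of the
points of the faces): it is constant on faces, and when one crosses an edge of the graph with an
endpoint in `D`, from the right to the left of its white-to-black orientation, it changes by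
`1 - ref e` if the edge is in `M` and by `- ref e` otherwise. -/
def IsHeight (ref : G.Edge → ℝ) (D : Set V) (M : G.Config) (h : ℂ → ℝ) : Prop :=
  (∀ z, ∀ z' ∈ G.face z, h z' = h z) ∧
  ∀ (a b : V) (hab : G.graph.Adj a b), a ∈ G.white → (a ∈ D ∨ b ∈ D) →
    ∀ z z', G.OnLeft a b z → G.OnLeft b a z' →
      h z - h z' = (if (⟨s(a, b), hab⟩ : G.Edge) ∈ M then 1 else 0) - ref ⟨s(a, b), hab⟩

/-- The face of `z` has a vertex of `D`: these are the faces on which heights on `D` live. -/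
def IsFaceOf (D : Set V) (z : ℂ) : Prop :=
  z ∉ G.skeleton ∧ ∃ v ∈ D, G.pos v ∈ closure (G.face z)

/-- The face of `z` is on the boundary of `D`: it has a vertex in `D` and a vertex outside `D`. -/
def IsBoundaryFace (D : Set V) (z : ℂ) : Prop :=
  G.IsFaceOf D z ∧ ∃ v ∉ D, G.pos v ∈ closure (G.face z)

/-- The faces of `z` and `z'` are the two sides of an edge with an endpoint in `D`. -/
def AdjacentFaces (D : Set V) (z z' : ℂ) : Prop :=
  ∃ u v, G.graph.Adj u v ∧ (u ∈ D ∨ v ∈ D) ∧ G.OnLeft u v z ∧ G.OnLeft v u z'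

/-- `h` chooses the height functions of all dimer configurations on `D`, with the additive
constants fixed on the boundary: every face of `D` is connected inside `D` to a boundary face
where the height does not depend on the configuration. -/
def IsNormalizedHeight (ref : G.Edge → ℝ) (D : Set V) (h : G.Config → ℂ → ℝ) : Prop :=
  (∀ M, G.IsDimer D M → G.IsHeight ref D M (h M)) ∧
  ∀ z, G.IsFaceOf D z → ∃ b, G.IsBoundaryFace D b ∧
    Relation.ReflTransGen (G.AdjacentFaces D) z b ∧
    ∀ M₁ M₂, G.IsDimer D M₁ → G.IsDimer D M₂ → h M₁ b = h M₂ b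

/-- For all configurations on `D` and on `D'`, the heights on the boundary of `D ∩ D'` differ by
at most `K`. -/
def BoundaryHeightsWithin (ref : G.Edge → ℝ) (D D' : Set V) (K : ℝ) : Prop :=
  ∃ h h' : G.Config → ℂ → ℝ, G.IsNormalizedHeight ref D h ∧ G.IsNormalizedHeight ref D' h' ∧
    ∀ M M', G.IsDimer D M → G.IsDimer D' M' →
      ∀ z, G.IsBoundaryFace (D ∩ D') z → |h' M' z - h M z| ≤ K

/-- The spread-out property. A height function on the whole plane is unique up to an additive
constant, which is fixed at a point `z` outside the ball; `H 0 - H z` is then the height at `0`. -/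
def SpreadOut (ref : G.Edge → ℝ) (μ : Measure G.Config) : Prop :=
  ∀ ε : ℝ, 0 < ε → ∃ R : ℝ, 0 < R ∧
    1 - ε < μ.real {m | ∀ z, z ∉ G.skeleton → R < ‖z‖ → ∀ x : ℝ,
      (G.specification R m).real {M | ∀ H, G.IsHeight ref Set.univ M H →
        H 0 - H z ∈ Set.Ioo x (x + 1)} ≤ ε}

/-! ### Local convergence -/

/-- `exp (- max R)` over the radii `R` such that the two configurations, as subsets of the plane,
agree on the ball of radius `R` around the origin (and `0` if they agree on all balls). -/
noncomputable def localDist (M N : G.Config) : ℝ :=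
  sInf {δ | ∃ R : ℝ, 0 ≤ R ∧ δ = Real.exp (-R) ∧
    G.drawing M ∩ Metric.ball 0 R = G.drawing N ∩ Metric.ball 0 R}

/-- Local convergence around the origin: convergence in law for the local distance. -/
def LocallyConverges (ν : ℕ → Measure G.Config) (μ : Measure G.Config) : Prop :=
  ∀ F : G.Config → ℝ, (∃ C, ∀ M, |F M| ≤ C) →
    (∀ M, ∀ ε > 0, ∃ δ > 0, ∀ N, G.localDist M N < δ → |F N - F M| < ε) →
    Tendsto (fun n => ∫ M, F M ∂(ν n)) atTop (𝓝 (∫ M, F M ∂μ))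

end PlaneBipartiteGraph

/-! Take independent configurations `M` on `D` and `M'` on `D'`, and call `h' M' - h M` the gap.
Explore the faces of `D ∩ D'` from its boundary inwards, through faces where the gap is at most `K`
in absolute value. The faces that are not reached are enclosed, and those next to explored faces
have a gap of absolute value in `(K, K + 1]`. Exchange `M` and `M'` on the edges with an enclosed
face on both sides (`gapEdges`).

The result is again a pair of dimer configurations: an edge in neither configuration has the same
gap on both sides, so at each vertex of `D ∩ D'` the two matched edges are exchanged together or not
at all (`IsDimer.swapOn_enclosedEdges`, based on the planar fact `FaceConst.rotate`). The product of
the weights is preserved. The exchange is an involution because the heights seen by the exploration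
do not change (`HeightPair.height_swap_eq`). This is the delicate point: an enclosed region may have
several borders, and the exchange reflects the gap inside it. Two borders with gaps of opposite
signs would force the gap to change by more than the bound `K` on the boundary allows. Hence `M` and
`M'` have the same law on a finite set `W` of edges, on the event that `W` is enclosed
(`HeightPair.sum_exchange`).

The gap changes by at most one from a face to the next, so a gap above `K + n` at the origin
encloses `W`, with `n` depending on `W` only (`exists_gap_subset_gapEdges`). It remains to see that
the gap at the origin is rarely at most `K + n`. By independence it is enough that `h M 0` is rarely
within `K + n` of a fixed number. This follows by resampling `M` in a disc near which it coincides
with a spread-out matching of the whole graph (`sum_good_near_le`). The latter condition depends on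
finitely many edges, so local convergence transfers its probability from `μ` to the domains `D n`.
-/

namespace PlaneBipartiteGraph

variable {V : Type*} (G : PlaneBipartiteGraph V)

/-! ### Planar geometry of edges and faces -/

lemma edgeSegment_mk {u v : V} (h : G.graph.Adj u v) :
    G.edgeSegment ⟨s(u, v), h⟩ = segment ℝ (G.pos u) (G.pos v) := by
  ext z
  constructor
  · rintro ⟨u', v', he, hz⟩
    rcases Sym2.eq_iff.1 he with ⟨rfl, rfl⟩ | ⟨rfl, rfl⟩
    · exact hz
    · rwa [segment_symm]
  · exact fun hz => ⟨u, v, rfl, hz⟩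

lemma exists_edge_eq (e : G.Edge) : ∃ u v, ∃ h : G.graph.Adj u v, e = ⟨s(u, v), h⟩ := by
  obtain ⟨e, he⟩ := e
  induction e using Sym2.ind with
  | _ u v => exact ⟨u, v, he, rfl⟩

lemma isClosed_edgeSegment (e : G.Edge) : IsClosed (G.edgeSegment e) := by
  obtain ⟨u, v, h, rfl⟩ := G.exists_edge_eq e
  rw [edgeSegment_mk, segment_eq_image']
  exact (isCompact_Icc.image (by fun_prop)).isClosed

lemma finite_edges_meeting (R : ℝ) :
    {e : G.Edge | (G.edgeSegment e ∩ Metric.closedBall 0 R).Nonempty}.Finite := by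
  refine (G.finite_edges R).subset ?_
  rintro e ⟨z, ⟨u, v, he, hz⟩, hzR⟩
  exact ⟨u, v, he, z, hz, hzR⟩

lemma locallyFinite_edgeSegment : LocallyFinite G.edgeSegment := by
  intro x
  refine ⟨Metric.closedBall 0 (‖x‖ + 1), ?_, G.finite_edges_meeting _⟩
  exact mem_of_superset (Metric.isOpen_ball.mem_nhds (by simp)) Metric.ball_subset_closedBall

lemma isClosed_drawing (A : G.Config) : IsClosed (G.drawing A) := by
  rw [drawing, Set.biUnion_eq_iUnion]
  exact (G.locallyFinite_edgeSegment.comp_injective Subtype.val_injective).isClosed_iUnion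
    fun e => G.isClosed_edgeSegment e

lemma isClosed_skeleton : IsClosed G.skeleton := G.isClosed_drawing _

lemma isOpen_face (z : ℂ) : IsOpen (G.face z) :=
  G.isClosed_skeleton.isOpen_compl.connectedComponentIn

variable {G}

lemma mem_face_self {z : ℂ} (hz : z ∉ G.skeleton) : z ∈ G.face z := mem_connectedComponentIn hz

lemma notMem_skeleton_of_mem_face {z z' : ℂ} (h : z' ∈ G.face z) : z' ∉ G.skeleton :=
  connectedComponentIn_subset _ _ h

lemma face_eq_of_mem {z z' : ℂ} (h : z' ∈ G.face z) : G.face z' = G.face z :=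
  (connectedComponentIn_eq h).symm

lemma subset_face {s : Set ℂ} {y z : ℂ} (hs : IsPreconnected s) (hsk : ∀ x ∈ s, x ∉ G.skeleton)
    (hy : y ∈ s) (hyz : y ∈ G.face z) : s ⊆ G.face z := by
  rw [← face_eq_of_mem hyz]
  exact hs.subset_connectedComponentIn hy hsk

lemma mem_skeleton_of_mem_segment {u v : V} (h : G.graph.Adj u v) {z : ℂ}
    (hz : z ∈ segment ℝ (G.pos u) (G.pos v)) : z ∈ G.skeleton := by
  rw [← edgeSegment_mk G h] at hz
  exact Set.mem_biUnion (Set.mem_univ _) hz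

lemma OnLeft.congr {u v : V} {z z' : ℂ} (h : G.OnLeft u v z) (hz : z' ∈ G.face z) :
    G.OnLeft u v z' := by
  refine ⟨notMem_skeleton_of_mem_face hz, ?_⟩
  rw [face_eq_of_mem hz]
  exact h.2

variable (G)

/-- The affine coordinate of the plane in which the edge from `u` to `v` is the real interval
`[0, 1]` and its left side is the upper half plane. -/
noncomputable def chart (u v : V) (w : ℂ) : ℂ := G.pos u + w * (G.pos v - G.pos u)

lemma continuous_chart (u v : V) : Continuous (G.chart u v) := by
  unfold chart; fun_prop

lemma chart_symm (u v : V) (w : ℂ) : G.chart v u w = G.chart u v (1 - w) := by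
  unfold chart; ring

variable {G}

lemma sub_pos_ne_zero {u v : V} (h : G.graph.Adj u v) : G.pos v - G.pos u ≠ 0 :=
  sub_ne_zero.2 fun h' => h.ne (G.pos_injective h').symm

lemma mem_segment_iff_chart {u v : V} {z : ℂ} :
    z ∈ segment ℝ (G.pos u) (G.pos v) ↔ ∃ s : ℝ, s ∈ Set.Icc (0 : ℝ) 1 ∧ z = G.chart u v s := by
  rw [segment_eq_image']
  constructor
  · rintro ⟨s, hs, rfl⟩
    exact ⟨s, hs, by simp [chart]⟩
  · rintro ⟨s, hs, rfl⟩
    exact ⟨s, hs, by simp [chart]⟩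

lemma chart_injective {u v : V} (h : G.graph.Adj u v) : Function.Injective (G.chart u v) := by
  intro a b hab
  simpa [chart, sub_pos_ne_zero h] using hab

/-- An interior point of an edge lies on no other edge. -/
lemma eq_of_chart_mem_edgeSegment {u v : V} (h : G.graph.Adj u v) {s : ℝ} (hs : s ∈ Set.Ioo (0 : ℝ) 1)
    {e : G.Edge} (he : G.chart u v s ∈ G.edgeSegment e) : e = ⟨s(u, v), h⟩ := by
  obtain ⟨u', v', h', rfl⟩ := G.exists_edge_eq e
  rw [edgeSegment_mk] at he
  by_contra hne
  have hne' : s(u, v) ≠ s(u', v') := fun hh => hne (Subtype.ext hh.symm)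
  obtain ⟨x, hx, hxe, -⟩ := G.noncrossing u v u' v' h h' hne' _
    ⟨mem_segment_iff_chart.2 ⟨s, ⟨hs.1.le, hs.2.le⟩, rfl⟩, he⟩
  rcases Sym2.mem_iff.1 hxe with rfl | rfl
  · have : G.chart x v (0 : ℂ) = G.chart x v s := by rw [← hx]; simp [chart]
    have := chart_injective h this
    exact hs.1.ne (by exact_mod_cast this)
  · have : G.chart u x (1 : ℂ) = G.chart u x s := by rw [← hx]; simp [chart]
    have := chart_injective h this
    exact hs.2.ne' (by exact_mod_cast this)

/-- Near a compact subinterval of an edge there are no other edges. -/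
lemma exists_thickening_chart {u v : V} (h : G.graph.Adj u v) {K : Set ℝ} (hK : IsCompact K)
    (hK1 : K ⊆ Set.Ioo 0 1) : ∃ δ > 0, ∀ w ∈ Metric.thickening δ ((↑) '' K : Set ℂ),
      G.chart u v w ∈ G.skeleton → w.im = 0 := by
  -- By local finiteness the union of the other edges is closed, and the compact set misses it.
  have hcl := G.isClosed_drawing {e | e ≠ ⟨s(u, v), h⟩}
  obtain ⟨δ, hδ, hsub⟩ := (hK.image Complex.continuous_ofReal).exists_thickening_subset_open
    (hcl.isOpen_compl.preimage (G.continuous_chart u v)) (by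
      rintro _ ⟨s, hs, rfl⟩ hmem
      obtain ⟨e, he, hse⟩ := Set.mem_iUnion₂.1 hmem
      exact he (eq_of_chart_mem_edgeSegment h (hK1 hs) hse))
  refine ⟨δ, hδ, fun w hw hsk => ?_⟩
  obtain ⟨e, -, hse⟩ := Set.mem_iUnion₂.1 hsk
  have he : e = ⟨s(u, v), h⟩ := by
    by_contra hne
    exact hsub hw (Set.mem_biUnion hne hse)
  subst he
  rw [edgeSegment_mk] at hse
  obtain ⟨s, -, hs⟩ := mem_segment_iff_chart.1 hse
  rw [chart_injective h hs, Complex.ofReal_im]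

lemma midpoint_chart (u v : V) (t : ℝ) :
    (G.pos u + G.pos v) / 2 + t * Complex.I * (G.pos v - G.pos u) =
      G.chart u v (1 / 2 + t * Complex.I) := by
  unfold chart; ring

lemma convex_upper (s : Set ℂ) (hs : Convex ℝ s) : Convex ℝ (s ∩ {w : ℂ | 0 < w.im}) :=
  hs.inter (convex_halfSpace_im_gt 0)

lemma half_add_mem (s : ℝ) {t δ : ℝ} (ht : 0 < t) (hδ : t < δ) {K : Set ℝ} (hs : s ∈ K) :
    (s + t * Complex.I : ℂ) ∈ Metric.thickening δ ((↑) '' K : Set ℂ) ∩ {w : ℂ | 0 < w.im} := by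
  constructor
  · refine Metric.mem_thickening_iff.2 ⟨s, ⟨s, hs, rfl⟩, ?_⟩
    simpa [dist_eq_norm, abs_of_pos ht] using hδ
  · simpa using ht

/-- The upper half discs around the interior points of an edge are in the face on its left. -/
lemma OnLeft.exists_halfDisc {u v : V} (h : G.graph.Adj u v) {z : ℂ} (hz : G.OnLeft u v z)
    {s : ℝ} (hs : s ∈ Set.Ioo (0 : ℝ) 1) :
    ∃ δ > 0, ∀ w : ℂ, ‖w - s‖ < δ → 0 < w.im → G.chart u v w ∈ G.face z := by
  -- `OnLeft` only speaks of points above the midpoint. The upper half of a thin neighbourhood of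
  -- the interval from `s` to `1 / 2` is convex and off the skeleton, so it carries this information
  -- to `s`.
  have hK1 : Set.uIcc s (1 / 2) ⊆ Set.Ioo (0 : ℝ) 1 :=
    (Set.ordConnected_Ioo).uIcc_subset hs ⟨by norm_num, by norm_num⟩
  obtain ⟨δ, hδ, hsk⟩ := exists_thickening_chart h isCompact_uIcc hK1
  refine ⟨δ, hδ, fun w hw hwim => ?_⟩
  set N := Metric.thickening δ ((↑) '' Set.uIcc s (1 / 2) : Set ℂ) ∩ {w : ℂ | 0 < w.im} with hN
  have hconv : Convex ℝ ((↑) '' Set.uIcc s (1 / 2) : Set ℂ) :=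
    (convex_uIcc s (1 / 2)).is_linear_image Complex.ofRealLI.toLinearMap.isLinear
  have hpre : IsPreconnected (G.chart u v '' N) :=
    (convex_upper _ (hconv.thickening δ)).isPreconnected.image _ (G.continuous_chart u v).continuousOn
  obtain ⟨t, htz, ht, htδ⟩ := (hz.2.and (Ioo_mem_nhdsGT hδ)).exists
  rw [midpoint_chart] at htz
  refine subset_face hpre ?_ (Set.mem_image_of_mem _ ?_) htz (Set.mem_image_of_mem _ ?_)
  · rintro _ ⟨w, hw, rfl⟩ hmem
    exact hw.2.ne' (hsk w hw.1 hmem)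
  · have := half_add_mem (1 / 2) ht htδ (K := Set.uIcc s (1 / 2)) Set.right_mem_uIcc
    push_cast at this
    exact this
  · exact ⟨Metric.mem_thickening_iff.2 ⟨s, ⟨s, Set.left_mem_uIcc, rfl⟩, by rwa [dist_eq_norm]⟩, hwim⟩

/-- The lower half discs around the interior points of an edge are in the face on its right. -/
lemma OnLeft.exists_halfDisc_right {u v : V} (h : G.graph.Adj u v) {z : ℂ} (hz : G.OnLeft v u z)
    {s : ℝ} (hs : s ∈ Set.Ioo (0 : ℝ) 1) :
    ∃ δ > 0, ∀ w : ℂ, ‖w - s‖ < δ → w.im < 0 → G.chart u v w ∈ G.face z := by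
  obtain ⟨δ, hδ, H⟩ := hz.exists_halfDisc h.symm (s := 1 - s) ⟨by linarith [hs.2], by linarith [hs.1]⟩
  refine ⟨δ, hδ, fun w hw hwim => ?_⟩
  have := H (1 - w) (by
    have : (1 - w - ((1 - s : ℝ) : ℂ)) = -(w - s) := by push_cast; ring
    rwa [this, norm_neg]) (by simpa using hwim)
  rwa [chart_symm, sub_sub_cancel] at this

lemma exists_onLeft {u v : V} (h : G.graph.Adj u v) : ∃ z, G.OnLeft u v z := by
  obtain ⟨δ, hδ, hsk⟩ := exists_thickening_chart h (isCompact_singleton (x := (1 / 2 : ℝ)))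
    (Set.singleton_subset_iff.2 ⟨by norm_num, by norm_num⟩)
  set N := Metric.thickening δ ((↑) '' {(1 / 2 : ℝ)} : Set ℂ) ∩ {w : ℂ | 0 < w.im} with hN
  have hpre : IsPreconnected (G.chart u v '' N) := by
    refine (convex_upper _ (Convex.thickening ?_ δ)).isPreconnected.image _
      (G.continuous_chart u v).continuousOn
    rw [Set.image_singleton]
    exact convex_singleton _
  have hmem : ∀ t ∈ Set.Ioo 0 δ, G.chart u v (1 / 2 + t * Complex.I) ∈ G.chart u v '' N := by
    intro t ht
    have := half_add_mem (1 / 2) ht.1 ht.2 (K := {(1 / 2 : ℝ)}) rfl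
    push_cast at this
    exact Set.mem_image_of_mem _ this
  have hout : ∀ x ∈ G.chart u v '' N, x ∉ G.skeleton := by
    rintro _ ⟨w, hw, rfl⟩ hmem
    exact hw.2.ne' (hsk w hw.1 hmem)
  have h2 := hmem (δ / 2) ⟨by linarith, by linarith⟩
  refine ⟨_, hout _ h2, ?_⟩
  filter_upwards [Ioo_mem_nhdsGT hδ] with t ht
  rw [midpoint_chart]
  exact subset_face hpre hout h2 (mem_face_self (hout _ h2)) (hmem t ht)

/-- An edge is in the closure of the face on its left. -/
lemma OnLeft.segment_subset {u v : V} (h : G.graph.Adj u v) {z : ℂ} (hz : G.OnLeft u v z) :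
    segment ℝ (G.pos u) (G.pos v) ⊆ closure (G.face z) := by
  refine segment_subset_closure_openSegment.trans (closure_minimal ?_ isClosed_closure)
  rw [openSegment_eq_image']
  rintro _ ⟨s, hs, rfl⟩
  obtain ⟨δ, hδ, H⟩ := hz.exists_halfDisc h hs
  have hlim : Tendsto (fun t : ℝ => G.chart u v (s + t * Complex.I)) (𝓝[>] 0)
      (𝓝 (G.chart u v (s + (0 : ℝ) * Complex.I))) := by
    refine Tendsto.mono_left ?_ nhdsWithin_le_nhds
    exact ((G.continuous_chart u v).comp (by fun_prop)).tendsto 0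
  have : G.chart u v (s + (0 : ℝ) * Complex.I) = G.pos u + s • (G.pos v - G.pos u) := by
    simp [chart]
  change G.pos u + s • (G.pos v - G.pos u) ∈ _
  rw [← this]
  refine mem_closure_of_tendsto hlim ?_
  filter_upwards [Ioo_mem_nhdsGT hδ] with t ht
  exact H _ (by simpa [abs_of_pos ht.1] using ht.2) (by simpa using ht.1)

lemma OnLeft.left_mem {u v : V} (h : G.graph.Adj u v) {z : ℂ} (hz : G.OnLeft u v z) :
    G.pos u ∈ closure (G.face z) := hz.segment_subset h (left_mem_segment _ _ _)

lemma OnLeft.right_mem {u v : V} (h : G.graph.Adj u v) {z : ℂ} (hz : G.OnLeft u v z) :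
    G.pos v ∈ closure (G.face z) := hz.segment_subset h (right_mem_segment _ _ _)

-- Each point of an edge is a limit of points of the face on its left. Two statements valid off the
-- skeleton near a common point can therefore be compared.
variable (G) in
lemma dense_compl_skeleton : Dense G.skeletonᶜ := by
  intro z
  by_cases hz : z ∈ G.skeleton
  · obtain ⟨e, -, hze⟩ := Set.mem_iUnion₂.1 hz
    obtain ⟨u, v, h, rfl⟩ := G.exists_edge_eq e
    rw [edgeSegment_mk] at hze
    obtain ⟨y, hy⟩ := exists_onLeft h
    exact closure_mono (fun x hx => notMem_skeleton_of_mem_face hx) (hy.segment_subset h hze)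
  · exact subset_closure hz

end PlaneBipartiteGraph

namespace PlaneBipartiteGraph

variable {V : Type*} {G : PlaneBipartiteGraph V}

/-! ### Propagation of face properties across edges -/

/-- `P` takes one value at the points near `p` which are on no edge. -/
def LocallyConstOffSkeleton (G : PlaneBipartiteGraph V) (P : ℂ → Prop) (p : ℂ) : Prop :=
  ∃ N ∈ 𝓝 p, ∀ z ∈ N, ∀ z' ∈ N, z ∉ G.skeleton → z' ∉ G.skeleton → (P z ↔ P z')

/-- A property which is locally constant off the skeleton is constant along preconnected sets. -/
lemma iff_of_locallyConst {P : ℂ → Prop} {U : Set ℂ} (hU : IsPreconnected U)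
    (hP : ∀ p ∈ U, G.LocallyConstOffSkeleton P p) {z z' : ℂ} (hz : z ∈ U) (hz' : z' ∈ U)
    (hzs : z ∉ G.skeleton) (hzs' : z' ∉ G.skeleton) : P z ↔ P z' := by
  -- The points near which `P` holds off the skeleton and those near which it fails there form two
  -- open sets covering `U`; a common point would contradict the density of the complement of the
  -- skeleton.
  have hopen : ∀ Q : ℂ → Prop, IsOpen {p | ∀ᶠ y in 𝓝 p, y ∉ G.skeleton → Q y} := fun Q =>
    isOpen_iff_mem_nhds.2 fun p hp => eventually_eventually_nhds.2 hp
  have hmem : ∀ p ∈ U, p ∉ G.skeleton → ∀ Q : ℂ → Prop, (∀ y y', (P y ↔ P y') → (Q y ↔ Q y')) →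
      Q p → ∀ᶠ y in 𝓝 p, y ∉ G.skeleton → Q y := by
    intro p hp hps Q hQ hQp
    obtain ⟨N, hN, H⟩ := hP p hp
    filter_upwards [hN] with y hy hys
    exact (hQ _ _ (H y hy p (mem_of_mem_nhds hN) hys hps)).2 hQp
  have hcover : U ⊆ {p | ∀ᶠ y in 𝓝 p, y ∉ G.skeleton → P y} ∪
      {p | ∀ᶠ y in 𝓝 p, y ∉ G.skeleton → ¬ P y} := by
    intro p hp
    obtain ⟨N, hN, H⟩ := hP p hp
    by_cases hex : ∃ y ∈ N, y ∉ G.skeleton ∧ P y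
    · obtain ⟨y, hy, hys, hPy⟩ := hex
      left
      filter_upwards [hN] with y' hy' hys'
      exact (H y hy y' hy' hys hys').1 hPy
    · right
      filter_upwards [hN] with y' hy' hys' hPy'
      exact hex ⟨y', hy', hys', hPy'⟩
  have key : ∀ x ∈ U, ∀ y ∈ U, x ∉ G.skeleton → y ∉ G.skeleton → P x → ¬ P y → False := by
    intro x hx y hy hxs hys hPx hPy
    obtain ⟨p, -, hp1, hp2⟩ := hU _ _ (hopen P) (hopen fun y => ¬ P y) hcover
      ⟨x, hx, hmem x hx hxs P (fun _ _ h => h) hPx⟩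
      ⟨y, hy, hmem y hy hys (fun y => ¬ P y) (fun _ _ h => not_congr h) hPy⟩
    obtain ⟨q, hq, hq'⟩ := mem_closure_iff_nhds.1 (G.dense_compl_skeleton p) _ (hp1.and hp2)
    exact hq.2 hq' (hq.1 hq')
  constructor
  · intro h
    by_contra h'
    exact key _ hz _ hz' hzs hzs' h h'
  · intro h
    by_contra h'
    exact key _ hz' _ hz hzs' hzs h h'

/-- `P` is a property of faces. -/
def FaceConst (G : PlaneBipartiteGraph V) (P : ℂ → Prop) : Prop :=
  ∀ z, ∀ z' ∈ G.face z, (P z' ↔ P z)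

/-- `P` has the same value on both sides of the edge from `u` to `v`. -/
def SameAcross (G : PlaneBipartiteGraph V) (P : ℂ → Prop) (u v : V) : Prop :=
  ∀ z z', G.OnLeft u v z → G.OnLeft v u z' → (P z ↔ P z')

lemma SameAcross.symm {P : ℂ → Prop} {u v : V} (h : G.SameAcross P u v) : G.SameAcross P v u :=
  fun z z' hz hz' => (h z' z hz' hz).symm

lemma FaceConst.locallyConst_of_notMem {P : ℂ → Prop} (hP : G.FaceConst P) {p : ℂ}
    (hp : p ∉ G.skeleton) : G.LocallyConstOffSkeleton P p :=
  ⟨G.face p, (G.isOpen_face p).mem_nhds (mem_face_self hp), fun z hz z' hz' _ _ =>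
    (hP p z hz).trans (hP p z' hz').symm⟩

lemma FaceConst.locallyConst_of_chart {P : ℂ → Prop} (hP : G.FaceConst P) {u v : V}
    (h : G.graph.Adj u v) (hc : G.SameAcross P u v) {s : ℝ} (hs : s ∈ Set.Ioo (0 : ℝ) 1) :
    G.LocallyConstOffSkeleton P (G.chart u v s) := by
  obtain ⟨l, hl⟩ := exists_onLeft h
  obtain ⟨r, hr⟩ := exists_onLeft h.symm
  obtain ⟨δ₁, hδ₁, H₁⟩ := hl.exists_halfDisc h hs
  obtain ⟨δ₂, hδ₂, H₂⟩ := hr.exists_halfDisc_right h hs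
  have hd := sub_pos_ne_zero h
  -- The bounds `δ₁`, `δ₂` give the half discs on both sides; `s` and `1 - s` keep the real points
  -- of the disc on the edge itself, hence on the skeleton.
  set δ := min (min δ₁ δ₂) (min s (1 - s)) with hδ
  have hδ0 : 0 < δ := by
    have := hs.1; have := sub_pos.2 hs.2
    simp only [hδ, lt_min_iff]; tauto
  let c : ℂ → ℂ := fun z => (z - G.pos u) / (G.pos v - G.pos u)
  have hcc : ∀ z, G.chart u v (c z) = z := fun z => by simp only [c, chart]; field_simp; ring
  have hcs : c (G.chart u v s) = s := by simp only [c, chart]; field_simp; ring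
  refine ⟨c ⁻¹' Metric.ball (s : ℂ) δ, ?_, ?_⟩
  · refine (Metric.isOpen_ball.preimage ?_).mem_nhds ?_
    · simp only [c]; fun_prop
    · simpa [hcs] using hδ0
  have key : ∀ z ∈ c ⁻¹' Metric.ball (s : ℂ) δ, z ∉ G.skeleton → (P z ↔ P l) := by
    intro z hz hzs
    have hz' : ‖c z - s‖ < δ := by simpa [dist_eq_norm] using hz
    simp only [hδ, lt_min_iff] at hz'
    rcases lt_trichotomy (c z).im 0 with him | him | him
    · have := H₂ _ hz'.1.2 him
      rw [hcc] at this
      exact (hP r z this).trans (hc l r hl hr).symm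
    · exfalso
      apply hzs
      have hre : c z = ((c z).re : ℂ) := Complex.ext rfl (by simpa using him)
      have habs : |(c z).re - s| < min s (1 - s) := by
        rw [hre, ← Complex.ofReal_sub, Complex.norm_real, Real.norm_eq_abs] at hz'
        simpa using hz'.2
      rw [lt_min_iff, abs_lt, abs_lt] at habs
      refine mem_skeleton_of_mem_segment h (mem_segment_iff_chart.2 ⟨(c z).re, ⟨?_, ?_⟩, ?_⟩)
      · linarith
      · linarith
      · rw [← hre, hcc]
    · have := H₁ _ hz'.1.1 him
      rw [hcc] at this
      exact hP l z this
  exact fun z hz z' hz' hzs hzs' => (key z hz hzs).trans (key z' hz' hzs').symm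

/-- Every point of the skeleton is a vertex or an interior point of an edge. -/
lemma mem_skeleton_cases {p : ℂ} (hp : p ∈ G.skeleton) :
    (∃ u v, G.graph.Adj u v ∧ G.pos u = p) ∨
      ∃ u v, ∃ _ : G.graph.Adj u v, ∃ s ∈ Set.Ioo (0 : ℝ) 1, p = G.chart u v s := by
  obtain ⟨e, -, he⟩ := Set.mem_iUnion₂.1 hp
  obtain ⟨u, v, h, rfl⟩ := G.exists_edge_eq e
  rw [edgeSegment_mk] at he
  obtain ⟨s, hs, rfl⟩ := mem_segment_iff_chart.1 he
  rcases hs.1.eq_or_lt with rfl | h0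
  · exact Or.inl ⟨u, v, h, by simp [chart]⟩
  rcases hs.2.eq_or_lt with rfl | h1
  · exact Or.inl ⟨v, u, h.symm, by simp [chart]⟩
  exact Or.inr ⟨u, v, h, s, ⟨h0, h1⟩, rfl⟩

/-- A face property which is the same on both sides of the edges met by a preconnected set without
vertices is constant on this set. -/
lemma FaceConst.iff_of_noVertex {P : ℂ → Prop} (hP : G.FaceConst P) {U : Set ℂ}
    (hU : IsPreconnected U) (hv : ∀ x, G.pos x ∉ U)
    (hc : ∀ u v, G.graph.Adj u v → (segment ℝ (G.pos u) (G.pos v) ∩ U).Nonempty →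
      G.SameAcross P u v) {z z' : ℂ} (hz : z ∈ U) (hz' : z' ∈ U)
    (hzs : z ∉ G.skeleton) (hzs' : z' ∉ G.skeleton) : P z ↔ P z' := by
  refine iff_of_locallyConst hU (fun p hp => ?_) hz hz' hzs hzs'
  by_cases hps : p ∈ G.skeleton
  · rcases mem_skeleton_cases hps with ⟨u, v, -, rfl⟩ | ⟨u, v, h, s, hs, rfl⟩
    · exact (hv u hp).elim
    · exact hP.locallyConst_of_chart h (hc u v h ⟨_, mem_segment_iff_chart.2
        ⟨s, ⟨hs.1.le, hs.2.le⟩, rfl⟩, hp⟩) hs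
  · exact hP.locallyConst_of_notMem hps

variable (G) in
/-- Around a vertex there is a disc which meets only the edges at this vertex, and no other
vertex. -/
lemma exists_disc_at_vertex (x : V) : ∃ ρ > 0, (∀ y, G.pos y ∈ Metric.ball (G.pos x) ρ → y = x) ∧
    ∀ u v, G.graph.Adj u v → (segment ℝ (G.pos u) (G.pos v) ∩ Metric.ball (G.pos x) ρ).Nonempty →
      u = x ∨ v = x := by
  have h1 : IsClosed (G.drawing {e | x ∉ e.1}) := G.isClosed_drawing _
  have h2 : IsClosed (G.pos '' {y | ‖G.pos y‖ ≤ ‖G.pos x‖ + 1 ∧ y ≠ x}) :=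
    (((G.finite_vertices _).subset fun y hy => hy.1).image _).isClosed
  have hx1 : G.pos x ∈ (G.drawing {e | x ∉ e.1})ᶜ := by
    intro hmem
    obtain ⟨e, he, hxe⟩ := Set.mem_iUnion₂.1 hmem
    obtain ⟨u, v, h, rfl⟩ := G.exists_edge_eq e
    rw [edgeSegment_mk] at hxe
    exact he (G.no_vertex_inside u v x h hxe)
  have hx2 : G.pos x ∈ (G.pos '' {y | ‖G.pos y‖ ≤ ‖G.pos x‖ + 1 ∧ y ≠ x})ᶜ := by
    rintro ⟨y, hy, hyx⟩
    exact hy.2 (G.pos_injective hyx)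
  obtain ⟨ρ₁, hρ₁, H₁⟩ := Metric.isOpen_iff.1 h1.isOpen_compl _ hx1
  obtain ⟨ρ₂, hρ₂, H₂⟩ := Metric.isOpen_iff.1 h2.isOpen_compl _ hx2
  refine ⟨min ρ₁ (min ρ₂ 1), by simp [hρ₁, hρ₂], fun y hy => ?_, fun u v h => ?_⟩
  · by_contra hne
    rw [Metric.mem_ball, lt_min_iff, lt_min_iff] at hy
    refine H₂ (Metric.mem_ball.2 hy.2.1) ⟨y, ⟨?_, hne⟩, rfl⟩
    have := norm_le_norm_add_norm_sub' (G.pos y) (G.pos x)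
    rw [← dist_eq_norm] at this
    linarith [hy.2.2]
  · rintro ⟨z, hz, hzb⟩
    by_contra hne
    rw [Metric.mem_ball, lt_min_iff] at hzb
    refine H₁ (Metric.mem_ball.2 hzb.1) (Set.mem_biUnion (x := ⟨s(u, v), h⟩) ?_ ?_)
    · simp only [Set.mem_ofPred_eq, Sym2.mem_iff]
      rintro (rfl | rfl) <;> simp at hne
    · rwa [edgeSegment_mk]

/-! ### Annuli, punctured discs, and turning around a vertex -/

lemma isPreconnected_polar (c : ℂ) (I J : Set ℝ) (hI : IsPreconnected I) (hJ : IsPreconnected J) :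
    IsPreconnected ((fun q : ℝ × ℝ => c + q.1 * Complex.exp (q.2 * Complex.I)) '' (I ×ˢ J)) :=
  (hI.prod hJ).image _ (by fun_prop)

lemma eq_polar (c z : ℂ) : z = c + ‖z - c‖ * Complex.exp ((z - c).arg * Complex.I) := by
  rw [Complex.norm_mul_exp_arg_mul_I]; ring

lemma isPreconnected_annulus (R R' : ℝ) (hR : 0 ≤ R) :
    IsPreconnected {z : ℂ | R < ‖z‖ ∧ ‖z‖ < R'} := by
  convert isPreconnected_polar 0 (Set.Ioo R R') Set.univ isPreconnected_Ioo isPreconnected_univ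
  ext z
  constructor
  · intro hz
    refine ⟨(‖z‖, z.arg), ⟨hz, trivial⟩, ?_⟩
    simp [Complex.norm_mul_exp_arg_mul_I]
  · rintro ⟨⟨r, t⟩, ⟨hr, -⟩, rfl⟩
    have : 0 < r := hR.trans_lt hr.1
    simpa [Complex.norm_exp_ofReal_mul_I, abs_of_pos this] using hr

lemma isPreconnected_puncturedDisc (c : ℂ) (ρ : ℝ) :
    IsPreconnected (Metric.ball c ρ \ {c}) := by
  convert isPreconnected_polar c (Set.Ioo 0 ρ) Set.univ isPreconnected_Ioo isPreconnected_univ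
  ext z
  constructor
  · rintro ⟨hz, hzc⟩
    refine ⟨(‖z - c‖, (z - c).arg), ⟨⟨?_, ?_⟩, trivial⟩, (eq_polar c z).symm⟩
    · exact norm_pos_iff.2 (sub_ne_zero.2 hzc)
    · simpa [dist_eq_norm] using hz
  · rintro ⟨⟨r, t⟩, ⟨hr, -⟩, rfl⟩
    have hr0 : 0 < r := hr.1
    constructor
    · simpa [dist_eq_norm, Complex.norm_exp_ofReal_mul_I, abs_of_pos hr0] using hr.2
    · simp [hr0.ne']

/-- A face property which is the same on both sides of the edges met by an open preconnected set
is constant on this set. -/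
lemma FaceConst.iff_of_isOpen {P : ℂ → Prop} (hP : G.FaceConst P) {U : Set ℂ}
    (hU : IsPreconnected U) (hUo : IsOpen U)
    (hc : ∀ u v, G.graph.Adj u v → (segment ℝ (G.pos u) (G.pos v) ∩ U).Nonempty →
      G.SameAcross P u v) {z z' : ℂ} (hz : z ∈ U) (hz' : z' ∈ U)
    (hzs : z ∉ G.skeleton) (hzs' : z' ∉ G.skeleton) : P z ↔ P z' := by
  refine iff_of_locallyConst hU (fun p hp => ?_) hz hz' hzs hzs'
  by_cases hps : p ∈ G.skeleton
  · rcases mem_skeleton_cases hps with ⟨u, v, h, rfl⟩ | ⟨u, v, h, s, hs, rfl⟩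
    -- A vertex is bypassed: the small punctured disc around it is connected and contains no vertex.
    · obtain ⟨ρ, hρ, hρv, -⟩ := G.exists_disc_at_vertex u
      obtain ⟨ρ', hρ', hsub⟩ := Metric.isOpen_iff.1 hUo _ hp
      refine ⟨Metric.ball (G.pos u) (min ρ ρ'), Metric.ball_mem_nhds _ (lt_min hρ hρ'),
        fun y hy y' hy' hys hys' => ?_⟩
      have hne : ∀ y, y ∉ G.skeleton → y ≠ G.pos u := by
        rintro _ hy rfl
        exact hy hps
      refine hP.iff_of_noVertex (isPreconnected_puncturedDisc (G.pos u) (min ρ ρ')) ?_ ?_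
        ⟨hy, hne y hys⟩ ⟨hy', hne y' hys'⟩ hys hys'
      · rintro x ⟨hx, hxu⟩
        exact hxu (by rw [hρv x (Metric.ball_subset_ball (min_le_left _ _) hx)]; rfl)
      · rintro a b hab ⟨q, hq, hqb, -⟩
        exact hc a b hab ⟨q, hq, hsub (Metric.ball_subset_ball (min_le_right _ _) hqb)⟩
    · exact hP.locallyConst_of_chart h (hc u v h ⟨_, mem_segment_iff_chart.2
        ⟨s, ⟨hs.1.le, hs.2.le⟩, rfl⟩, hp⟩) hs
  · exact hP.locallyConst_of_notMem hps

/-- Used to see that an arc which leaves an edge and turns by less than a full turn does not meet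
this edge again. -/
lemma exp_mul_I_ne_ofReal {θ : ℝ} (h0 : 0 < θ) (h1 : θ < 2 * Real.pi) {s : ℝ} (hs : 0 ≤ s) :
    Complex.exp (θ * Complex.I) ≠ s := by
  intro h
  have h2 : s = 1 := by
    have := congrArg norm h
    rw [Complex.norm_exp_ofReal_mul_I, Complex.norm_real, Real.norm_eq_abs, abs_of_nonneg hs] at this
    exact this.symm
  rw [h2, Complex.ofReal_one, Complex.exp_eq_one_iff] at h
  obtain ⟨n, hn⟩ := h
  have hn' : θ = n * (2 * Real.pi) := by
    have : (θ : ℂ) = n * (2 * Real.pi) := by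
      apply mul_right_cancel₀ Complex.I_ne_zero
      rw [hn]; ring
    exact_mod_cast this
  have hpi := Real.pi_pos
  have h3 : (0 : ℝ) < n := by
    by_contra hn0
    nlinarith
  have h4 : (n : ℝ) < 1 := by
    by_contra hn1
    nlinarith
  have h5 : 0 < n := by exact_mod_cast h3
  have h6 : n < 1 := by exact_mod_cast h4
  omega

/-- Turning counterclockwise requires an angle in `(0, 2π)`, so negative values of `arg` are shifted
by `2π`. -/
lemma exists_angle {q : ℂ} (hreal : ¬ ∃ s : ℝ, 0 ≤ s ∧ q = s) :
    ∃ ψ : ℝ, 0 < ψ ∧ ψ < 2 * Real.pi ∧ q = ‖q‖ * Complex.exp (ψ * Complex.I) := by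
  have hpi := Real.pi_pos
  rcases lt_trichotomy q.arg 0 with h | h | h
  · refine ⟨q.arg + 2 * Real.pi, by linarith [Complex.neg_pi_lt_arg q], by linarith, ?_⟩
    push_cast
    rw [add_mul, Complex.exp_add, Complex.exp_two_pi_mul_I, mul_one,
      Complex.norm_mul_exp_arg_mul_I]
  · refine (hreal ⟨‖q‖, norm_nonneg _, ?_⟩).elim
    conv_lhs => rw [← Complex.norm_mul_exp_arg_mul_I q, h]
    simp
  · exact ⟨q.arg, h, by linarith [Complex.arg_le_pi q], (Complex.norm_mul_exp_arg_mul_I q).symm⟩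

/-- Two different edges at a vertex point in different directions. -/
lemma direction_ne {x w w' : V} (h : G.graph.Adj x w) (h' : G.graph.Adj x w') (hne : w ≠ w') :
    ¬ ∃ s : ℝ, 0 ≤ s ∧ (G.pos w' - G.pos x) / (G.pos w - G.pos x) = s := by
  rintro ⟨s, hs, heq⟩
  have hd := sub_pos_ne_zero h
  rw [div_eq_iff hd] at heq
  have hs0 : 0 < s := by
    refine hs.lt_of_ne fun h0 => sub_pos_ne_zero h' ?_
    rw [heq, ← h0]; simp
  rcases le_or_gt s 1 with h1 | h1
  · have : w' ∈ s(x, w) := G.no_vertex_inside x w w' h (mem_segment_iff_chart.2 ⟨s, ⟨hs, h1⟩, by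
      rw [chart, ← heq]; ring⟩)
    rcases Sym2.mem_iff.1 this with rfl | rfl
    · exact h'.ne rfl
    · exact hne rfl
  · have : w ∈ s(x, w') := G.no_vertex_inside x w' w h' (mem_segment_iff_chart.2
      ⟨s⁻¹, ⟨by positivity, inv_le_one_of_one_le₀ h1.le⟩, by
        rw [chart, heq]
        have : (s : ℂ) ≠ 0 := by exact_mod_cast hs0.ne'
        push_cast; field_simp; ring⟩)
    rcases Sym2.mem_iff.1 this with rfl | rfl
    · exact h.ne rfl
    · exact hne rfl

/-- Turning counterclockwise around a vertex `x` from the edge `xw` to the edge `xw'`. -/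
lemma FaceConst.rotate {P : ℂ → Prop} (hP : G.FaceConst P) {x w w' : V} (h : G.graph.Adj x w)
    (h' : G.graph.Adj x w') (hne : w ≠ w')
    (hc : ∀ y, G.graph.Adj x y → y ≠ w → y ≠ w' → G.SameAcross P x y) {l r : ℂ}
    (hl : G.OnLeft x w l) (hr : G.OnLeft w' x r) : P l ↔ P r := by
  have hd := sub_pos_ne_zero h
  have hd' := sub_pos_ne_zero h'
  obtain ⟨ψ, hψ0, hψ1, hψ⟩ := exists_angle (direction_ne h h' hne)
  set q := ‖(G.pos w' - G.pos x) / (G.pos w - G.pos x)‖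
  have hq0 : 0 < q := norm_pos_iff.2 (div_ne_zero hd' hd)
  rw [div_eq_iff hd] at hψ
  obtain ⟨ρ, hρ, hρv, hρe⟩ := G.exists_disc_at_vertex x
  have hdn : 0 < ‖G.pos w - G.pos x‖ := norm_pos_iff.2 hd
  -- Lengths are measured in units of the edge `xw`. The bounds `1` and `q` put the ends of the arc
  -- `γ` in the interiors of `xw` and `xw'`; the last bound keeps `γ` in the disc that meets only
  -- edges at `x`. In the chart of `xw'`, `γ` has radius `r₀ / q` and its angle is shifted by `-ψ`.
  obtain ⟨r₀, hr₀, hr₁⟩ : ∃ r₀ : ℝ, 0 < r₀ ∧ r₀ < min (min 1 q) (ρ / ‖G.pos w - G.pos x‖) :=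
    exists_between (by positivity)
  simp only [lt_min_iff] at hr₁
  have hqC : (q : ℂ) ≠ 0 := by exact_mod_cast hq0.ne'
  let γ : ℝ → ℂ := fun θ => G.chart x w (r₀ * Complex.exp (θ * Complex.I))
  have hγc : Continuous γ := (G.continuous_chart x w).comp (by fun_prop)
  have hγ' : ∀ θ, γ θ = G.chart x w' ((r₀ / q : ℝ) * Complex.exp ((θ - ψ : ℝ) * Complex.I)) := by
    intro θ
    simp only [γ, chart]
    rw [hψ]
    push_cast
    rw [sub_mul, Complex.exp_sub]
    have := Complex.exp_ne_zero (ψ * Complex.I)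
    field_simp
  have hγball : ∀ θ, γ θ ∈ Metric.ball (G.pos x) ρ := by
    intro θ
    rw [lt_div_iff₀ hdn] at hr₁
    simpa [γ, chart, dist_eq_norm, Complex.norm_exp_ofReal_mul_I, abs_of_pos hr₀] using hr₁.2
  have hγx : ∀ θ, γ θ ≠ G.pos x := by
    intro θ
    simp [γ, chart, hr₀.ne', hd]
  have hpre : IsPreconnected (γ '' Set.Ioo 0 ψ) := isPreconnected_Ioo.image _ hγc.continuousOn
  have hcross : ∀ u v, G.graph.Adj u v →
      (segment ℝ (G.pos u) (G.pos v) ∩ γ '' Set.Ioo 0 ψ).Nonempty → G.SameAcross P u v := by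
    have main : ∀ v, G.graph.Adj x v →
        (segment ℝ (G.pos x) (G.pos v) ∩ γ '' Set.Ioo 0 ψ).Nonempty → G.SameAcross P x v := by
      rintro v hv ⟨_, hseg, θ, hθ, rfl⟩
      obtain ⟨s, hs, hseq⟩ := mem_segment_iff_chart.1 hseg
      refine hc v hv ?_ ?_
      · rintro rfl
        have := chart_injective h hseq
        refine exp_mul_I_ne_ofReal hθ.1 (hθ.2.trans hψ1) (s := s / r₀) (div_nonneg hs.1 hr₀.le) ?_
        have hr₀C : (r₀ : ℂ) ≠ 0 := by exact_mod_cast hr₀.ne'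
        push_cast
        rw [← this]; field_simp
      · rintro rfl
        rw [hγ'] at hseq
        have := chart_injective h' hseq
        -- The angle `θ - ψ` from `xw'` is negative; one full turn brings it into `(0, 2π)`.
        refine exp_mul_I_ne_ofReal (θ := θ - ψ + 2 * Real.pi) (by linarith [hθ.1])
          (by linarith [hθ.2]) (s := s / (r₀ / q)) (div_nonneg hs.1 (by positivity)) ?_
        have hr₀C : ((r₀ / q : ℝ) : ℂ) ≠ 0 := by exact_mod_cast (div_pos hr₀ hq0).ne'
        rw [Complex.ofReal_div s, ← this, mul_div_cancel_left₀ _ hr₀C, Complex.ofReal_add, add_mul,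
          Complex.exp_add]
        push_cast
        rw [Complex.exp_two_pi_mul_I, mul_one]
    rintro u v huv ⟨p, hp, θ, hθ, rfl⟩
    rcases hρe u v huv ⟨_, hp, hγball θ⟩ with rfl | rfl
    · exact main v huv ⟨_, hp, θ, hθ, rfl⟩
    · rw [segment_symm] at hp
      exact (main u huv.symm ⟨_, hp, θ, hθ, rfl⟩).symm
  obtain ⟨δ₁, hδ₁, H₁⟩ := hl.exists_halfDisc h (s := r₀) ⟨hr₀, hr₁.1.1⟩
  obtain ⟨δ₂, hδ₂, H₂⟩ := hr.exists_halfDisc_right h' (s := r₀ / q)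
    ⟨by positivity, (div_lt_one hq0).2 hr₁.1.2⟩
  have hpi := Real.pi_pos
  -- Just after `0` the arc is in a half disc on the left of `xw`; just before `ψ` it is in one on
  -- the right of `xw'`.
  obtain ⟨θ₁, hθ₁, hθ₁l⟩ : ∃ θ ∈ Set.Ioo 0 ψ, γ θ ∈ G.face l := by
    have hlim : Tendsto (fun θ : ℝ => ‖(r₀ * Complex.exp (θ * Complex.I) - r₀ : ℂ)‖) (𝓝[>] 0)
        (𝓝 0) := by
      refine Tendsto.mono_left ?_ nhdsWithin_le_nhds
      have : Continuous (fun θ : ℝ => ‖(r₀ * Complex.exp (θ * Complex.I) - r₀ : ℂ)‖) := by fun_prop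
      simpa using this.tendsto 0
    obtain ⟨θ, hθ, h1, h2⟩ := ((hlim.eventually (gt_mem_nhds hδ₁)).and
      (Ioo_mem_nhdsGT (lt_min hψ0 hpi))).exists
    rw [lt_min_iff] at h2
    refine ⟨θ, ⟨h1, h2.1⟩, H₁ _ hθ ?_⟩
    rw [Complex.im_ofReal_mul, Complex.exp_ofReal_mul_I_im]
    exact mul_pos hr₀ (Real.sin_pos_of_pos_of_lt_pi h1 h2.2)
  obtain ⟨θ₂, hθ₂, hθ₂r⟩ : ∃ θ ∈ Set.Ioo 0 ψ, γ θ ∈ G.face r := by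
    have hlim : Tendsto (fun θ : ℝ => ‖((r₀ / q : ℝ) * Complex.exp ((θ - ψ : ℝ) * Complex.I)
        - (r₀ / q : ℝ) : ℂ)‖) (𝓝[<] ψ) (𝓝 0) := by
      refine Tendsto.mono_left ?_ nhdsWithin_le_nhds
      have : Continuous (fun θ : ℝ => ‖((r₀ / q : ℝ) * Complex.exp ((θ - ψ : ℝ) * Complex.I)
        - (r₀ / q : ℝ) : ℂ)‖) := by fun_prop
      simpa using this.tendsto ψ
    obtain ⟨θ, hθ, h1, h2⟩ := ((hlim.eventually (gt_mem_nhds hδ₂)).and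
      (Ioo_mem_nhdsLT (show max 0 (ψ - Real.pi) < ψ by simp [hψ0, hpi]))).exists
    rw [max_lt_iff] at h1
    refine ⟨θ, ⟨h1.1, h2⟩, ?_⟩
    rw [hγ']
    refine H₂ _ hθ ?_
    rw [Complex.im_ofReal_mul, Complex.exp_ofReal_mul_I_im]
    exact mul_neg_of_pos_of_neg (div_pos hr₀ hq0)
      (Real.sin_neg_of_neg_of_neg_pi_lt (by linarith) (by linarith [h1.2]))
  have := hP.iff_of_noVertex hpre (fun y ⟨θ, _, hy⟩ => ?_) hcross
    (Set.mem_image_of_mem γ hθ₁) (Set.mem_image_of_mem γ hθ₂)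
    (notMem_skeleton_of_mem_face hθ₁l) (notMem_skeleton_of_mem_face hθ₂r)
  · rwa [hP l _ hθ₁l, hP r _ hθ₂r] at this
  · have : y = x := hρv y (hy ▸ hγball θ)
    exact hγx θ (by rw [hy, this])

end PlaneBipartiteGraph

namespace PlaneBipartiteGraph

variable {V : Type*} {G : PlaneBipartiteGraph V}

/-! ### Heights across edges -/

open Classical in
/-- The indicator function of a configuration. -/
noncomputable def ind (M : G.Config) (e : G.Edge) : ℝ := if e ∈ M then 1 else 0

open Classical in
/-- `1` at the white vertices and `-1` at the black vertices. -/
noncomputable def orient (G : PlaneBipartiteGraph V) (u : V) : ℝ := if u ∈ G.white then 1 else -1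

lemma ind_eq_zero_or_one (M : G.Config) (e : G.Edge) : ind M e = 0 ∨ ind M e = 1 := by
  unfold ind; split_ifs <;> simp

lemma ind_congr {M N : G.Config} {e : G.Edge} (h : e ∈ M ↔ e ∈ N) : ind M e = ind N e := by
  by_cases hN : e ∈ N
  · rw [ind, ind, if_pos hN, if_pos (h.2 hN)]
  · rw [ind, ind, if_neg hN, if_neg (h.not.2 hN)]

lemma orient_eq (u : V) : G.orient u = 1 ∨ G.orient u = -1 := by
  unfold orient; split_ifs <;> simp

/-- The sign `orient u` absorbs the white-to-black convention, so that an edge can be crossed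
without distinguishing the colours of its ends. -/
lemma IsHeight.sub_eq {ref : G.Edge → ℝ} {D : Set V} {M : G.Config} {h : ℂ → ℝ}
    (hh : G.IsHeight ref D M h) {u v : V} (huv : G.graph.Adj u v) (hD : u ∈ D ∨ v ∈ D) {z z' : ℂ}
    (hz : G.OnLeft u v z) (hz' : G.OnLeft v u z') :
    h z - h z' = G.orient u * (ind M ⟨s(u, v), huv⟩ - ref ⟨s(u, v), huv⟩) := by
  by_cases hu : u ∈ G.white
  · rw [hh.2 u v huv hu hD z z' hz hz']
    simp [orient, hu, ind]
  · have hv : v ∈ G.white := by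
      by_contra hv
      exact hu ((G.bipartite u v huv).2 hv)
    have := hh.2 v u huv.symm hv hD.symm z' z hz' hz
    have he : (⟨s(v, u), huv.symm⟩ : G.Edge) = ⟨s(u, v), huv⟩ := Subtype.ext Sym2.eq_swap
    rw [he] at this
    simp only [orient, hu, if_false, ind]
    linarith

lemma mem_face_symm {z z' : ℂ} (h : z' ∈ G.face z) : z ∈ G.face z' := by
  rw [face_eq_of_mem h]
  exact mem_face_self (connectedComponentIn_nonempty_iff.1 ⟨z', h⟩)

lemma AdjacentFaces.symm {D : Set V} {z z' : ℂ} (h : G.AdjacentFaces D z z') :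
    G.AdjacentFaces D z' z := by
  obtain ⟨u, v, huv, hD, hz, hz'⟩ := h
  exact ⟨v, u, huv.symm, hD.symm, hz', hz⟩

lemma AdjacentFaces.congr {D : Set V} {z y y' : ℂ} (h : G.AdjacentFaces D z y)
    (hy : y' ∈ G.face y) : G.AdjacentFaces D z y' := by
  obtain ⟨u, v, huv, hD, hz, hz'⟩ := h
  exact ⟨u, v, huv, hD, hz, hz'.congr hy⟩

lemma IsFaceOf.congr {D : Set V} {z z' : ℂ} (h : G.IsFaceOf D z) (hz : z' ∈ G.face z) :
    G.IsFaceOf D z' := by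
  obtain ⟨-, v, hv, hvz⟩ := h
  exact ⟨notMem_skeleton_of_mem_face hz, v, hv, by rwa [face_eq_of_mem hz]⟩

lemma IsBoundaryFace.congr {D : Set V} {z z' : ℂ} (h : G.IsBoundaryFace D z)
    (hz : z' ∈ G.face z) : G.IsBoundaryFace D z' := by
  refine ⟨h.1.congr hz, ?_⟩
  rw [face_eq_of_mem hz]
  exact h.2

lemma AdjacentFaces.isFaceOf {D : Set V} {z z' : ℂ} (h : G.AdjacentFaces D z z') :
    G.IsFaceOf D z := by
  obtain ⟨u, v, huv, hD | hD, hz, -⟩ := h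
  · exact ⟨hz.1, u, hD, hz.left_mem huv⟩
  · exact ⟨hz.1, v, hD, hz.right_mem huv⟩

/-! ### Enclosed faces -/

/-- The faces of `E` which are reached from the boundary of `E` through faces with the
property `Q`. -/
inductive Explored (G : PlaneBipartiteGraph V) (E : Set V) (Q : ℂ → Prop) : ℂ → Prop
  | base {z : ℂ} : G.IsBoundaryFace E z → Explored G E Q z
  | step {z z' : ℂ} : Explored G E Q z → G.AdjacentFaces E z z' → Q z' → Explored G E Q z'

/-- The faces of `E` which are not reached from its boundary. -/
def Enclosed (G : PlaneBipartiteGraph V) (E : Set V) (Q : ℂ → Prop) (z : ℂ) : Prop :=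
  G.IsFaceOf E z ∧ ¬ G.Explored E Q z

/-- The edges which have an enclosed face on both sides. -/
def enclosedEdges (G : PlaneBipartiteGraph V) (E : Set V) (Q : ℂ → Prop) : Set G.Edge :=
  {e | ∀ u v, e.1 = s(u, v) → ∀ z, G.OnLeft u v z → G.Enclosed E Q z}

section

variable {E : Set V} {Q : ℂ → Prop}

lemma Explored.isFaceOf {z : ℂ} (h : G.Explored E Q z) : G.IsFaceOf E z := by
  cases h with
  | base h => exact h.1
  | step _ h _ => exact h.symm.isFaceOf

lemma faceConst_enclosed (hQ : G.FaceConst Q) : G.FaceConst (G.Enclosed E Q) := by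
  have h1 : ∀ {z z' : ℂ}, z' ∈ G.face z → G.Explored E Q z → G.Explored E Q z' := by
    intro z z' hz h
    cases h with
    | base h => exact .base (h.congr hz)
    | step h hadj hq => exact .step h (hadj.congr hz) ((hQ _ _ hz).2 hq)
  intro z z' hz
  exact and_congr ⟨fun h => h.congr (mem_face_symm hz), fun h => h.congr hz⟩
    (not_congr ⟨h1 (mem_face_symm hz), h1 hz⟩)

/-- Boundary faces are explored from the start, so an enclosed face has no vertex outside `E`. This
is what allows the use of both heights around it. -/
lemma Enclosed.mem_of_mem_closure {z : ℂ} (h : G.Enclosed E Q z) {v : V}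
    (hv : G.pos v ∈ closure (G.face z)) : v ∈ E := by
  by_contra hvE
  exact h.2 (.base ⟨h.1, v, hvE, hv⟩)

lemma FaceConst.iff_of_onLeft {P : ℂ → Prop} (hP : G.FaceConst P) {u v : V} {z y : ℂ}
    (hz : G.OnLeft u v z) (hy : G.OnLeft u v y) : P z ↔ P y := by
  obtain ⟨t, ht, ht'⟩ := (hz.2.and hy.2).exists
  exact (hP z _ ht).symm.trans (hP y _ ht')

lemma mem_enclosedEdges_iff (hQ : G.FaceConst Q) {u v : V} (huv : G.graph.Adj u v) {z z' : ℂ}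
    (hz : G.OnLeft u v z) (hz' : G.OnLeft v u z') :
    (⟨s(u, v), huv⟩ : G.Edge) ∈ G.enclosedEdges E Q ↔ G.Enclosed E Q z ∧ G.Enclosed E Q z' := by
  constructor
  · exact fun h => ⟨h u v rfl z hz, h v u Sym2.eq_swap z' hz'⟩
  · rintro ⟨h, h'⟩ a b hab y hy
    rcases Sym2.eq_iff.1 hab with ⟨rfl, rfl⟩ | ⟨rfl, rfl⟩
    · exact ((faceConst_enclosed hQ).iff_of_onLeft hy hz).2 h
    · exact ((faceConst_enclosed hQ).iff_of_onLeft hy hz').2 h'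

lemma mem_of_mem_enclosedEdges {e : G.Edge} (he : e ∈ G.enclosedEdges E Q) {v : V}
    (hv : v ∈ e.1) : v ∈ E := by
  obtain ⟨u, w, huw, rfl⟩ := G.exists_edge_eq e
  obtain ⟨z, hz⟩ := exists_onLeft huw
  have := he u w rfl z hz
  rcases Sym2.mem_iff.1 hv with rfl | rfl
  · exact this.mem_of_mem_closure (hz.left_mem huw)
  · exact this.mem_of_mem_closure (hz.right_mem huw)

/-- If one side is explored, then it satisfies `Q`, hence so does the other side, and the
exploration crosses the edge. -/
lemma SameAcross.enclosed {u v : V} (huv : G.graph.Adj u v) (hE : u ∈ E ∨ v ∈ E)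
    (h : G.SameAcross Q u v) (hlow : ∀ z, G.Explored E Q z → Q z) :
    G.SameAcross (G.Enclosed E Q) u v := by
  intro z z' hz hz'
  have hadj : G.AdjacentFaces E z z' := ⟨u, v, huv, hE, hz, hz'⟩
  refine and_congr ⟨fun _ => hadj.symm.isFaceOf, fun _ => hadj.isFaceOf⟩ (not_congr ⟨?_, ?_⟩)
  · exact fun hT => hT.step hadj ((h z z' hz hz').1 (hlow z hT))
  · exact fun hT => hT.step hadj.symm ((h z z' hz hz').2 (hlow z' hT))

/-- The edges `xw` and `xw'` cut a small circle around `x` into two arcs. Being enclosed is constant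
along each arc, and each arc links one side of `xw` to one side of `xw'`. -/
lemma mem_enclosedEdges_of_rotate (hQ : G.FaceConst Q) (hlow : ∀ z, G.Explored E Q z → Q z)
    {x w w' : V} (hx : x ∈ E)
    (h : G.graph.Adj x w) (h' : G.graph.Adj x w')
    (hc : ∀ y, G.graph.Adj x y → y ≠ w → y ≠ w' → G.SameAcross Q x y)
    (hw : (⟨s(x, w), h⟩ : G.Edge) ∈ G.enclosedEdges E Q) :
    (⟨s(x, w'), h'⟩ : G.Edge) ∈ G.enclosedEdges E Q := by
  by_cases hne : w = w'
  · subst hne; exact hw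
  obtain ⟨l, hl⟩ := exists_onLeft h
  obtain ⟨r, hr⟩ := exists_onLeft h.symm
  obtain ⟨l', hl'⟩ := exists_onLeft h'
  obtain ⟨r', hr'⟩ := exists_onLeft h'.symm
  have hP := faceConst_enclosed (E := E) hQ
  rw [mem_enclosedEdges_iff hQ h hl hr] at hw
  rw [mem_enclosedEdges_iff hQ h' hl' hr']
  exact ⟨(hP.rotate h' h (Ne.symm hne) (fun y hy h1 h2 =>
      (hc y hy h2 h1).enclosed hy (Or.inl hx) hlow) hl' hr).2 hw.2,
    (hP.rotate h h' hne (fun y hy h1 h2 =>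
      (hc y hy h1 h2).enclosed hy (Or.inl hx) hlow) hl hr').1 hw.1⟩

end

/-! ### Exchanging two configurations -/

/-- The configuration which is `N` on the edges of `A` and `M` on the other edges. -/
def swapOn (A : Set G.Edge) (M N : G.Config) : G.Config := {e | (e ∈ A ∧ e ∈ N) ∨ (e ∉ A ∧ e ∈ M)}

lemma mem_swapOn_of_mem {A : Set G.Edge} {M N : G.Config} {e : G.Edge} (he : e ∈ A) :
    e ∈ swapOn A M N ↔ e ∈ N := by simp [swapOn, he]

lemma mem_swapOn_of_notMem {A : Set G.Edge} {M N : G.Config} {e : G.Edge} (he : e ∉ A) :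
    e ∈ swapOn A M N ↔ e ∈ M := by simp [swapOn, he]

lemma swapOn_swapOn (A : Set G.Edge) (M N : G.Config) :
    swapOn A (swapOn A M N) (swapOn A N M) = M := by
  ext e
  by_cases he : e ∈ A
  · rw [mem_swapOn_of_mem he, mem_swapOn_of_mem he]
  · rw [mem_swapOn_of_notMem he, mem_swapOn_of_notMem he]

lemma exists_edge_at (e : G.Edge) {x : V} (hx : x ∈ e.1) :
    ∃ w, ∃ h : G.graph.Adj x w, e = ⟨s(x, w), h⟩ := by
  obtain ⟨u, v, h, rfl⟩ := G.exists_edge_eq e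
  rcases Sym2.mem_iff.1 hx with rfl | rfl
  · exact ⟨v, h, rfl⟩
  · exact ⟨u, h.symm, Subtype.ext Sym2.eq_swap⟩

/-- Exchanging two dimer configurations on the enclosed edges gives a dimer configuration. -/
lemma IsDimer.swapOn_enclosedEdges {D D' : Set V} {M M' : G.Config} (hM : G.IsDimer D M)
    (hM' : G.IsDimer D' M') {Q : ℂ → Prop} (hQ : G.FaceConst Q)
    (hlow : ∀ z, G.Explored (D ∩ D') Q z → Q z)
    (hc : ∀ u v, ∀ h : G.graph.Adj u v, u ∈ D ∩ D' → ⟨s(u, v), h⟩ ∉ M → ⟨s(u, v), h⟩ ∉ M' →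
      G.SameAcross Q u v) :
    G.IsDimer D (swapOn (G.enclosedEdges (D ∩ D') Q) M M') := by
  set A := G.enclosedEdges (D ∩ D') Q
  refine ⟨?_, fun x hx => ?_⟩
  · rintro e (⟨heA, -⟩ | ⟨-, he⟩) v hv
    · exact (mem_of_mem_enclosedEdges heA hv).1
    · exact hM.1 e he v hv
  obtain ⟨e, ⟨he, hxe⟩, hu⟩ := hM.2 x hx
  by_cases hx' : x ∈ D'
  · obtain ⟨e', ⟨he', hxe'⟩, hu'⟩ := hM'.2 x hx'
    -- All edges at `x` other than `e` and `e'` are in neither configuration, so one can turn around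
    -- `x` between these two.
    have key : e ∈ A ↔ e' ∈ A := by
      obtain ⟨w, h, rfl⟩ := exists_edge_at e hxe
      obtain ⟨w', h', rfl⟩ := exists_edge_at e' hxe'
      have hc' : ∀ y, G.graph.Adj x y → y ≠ w → y ≠ w' → G.SameAcross Q x y := by
        intro y hy h1 h2
        refine hc x y hy ⟨hx, hx'⟩ (fun hm => h1 ?_) (fun hm => h2 ?_)
        · have := congrArg Subtype.val (hu _ ⟨hm, Sym2.mem_mk_left x y⟩)
          exact Sym2.congr_right.1 this
        · have := congrArg Subtype.val (hu' _ ⟨hm, Sym2.mem_mk_left x y⟩)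
          exact Sym2.congr_right.1 this
      exact ⟨mem_enclosedEdges_of_rotate hQ hlow ⟨hx, hx'⟩ h h' hc',
        mem_enclosedEdges_of_rotate hQ hlow ⟨hx, hx'⟩ h' h fun y hy h1 h2 => hc' y hy h2 h1⟩
    by_cases heA : e ∈ A
    · refine ⟨e', ⟨Or.inl ⟨key.1 heA, he'⟩, hxe'⟩, ?_⟩
      rintro f ⟨⟨-, hf⟩ | ⟨hfA, hf⟩, hxf⟩
      · exact hu' f ⟨hf, hxf⟩
      · exact (hfA (hu f ⟨hf, hxf⟩ ▸ heA)).elim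
    · refine ⟨e, ⟨Or.inr ⟨heA, he⟩, hxe⟩, ?_⟩
      rintro f ⟨⟨hfA, hf⟩ | ⟨-, hf⟩, hxf⟩
      · exact (heA (key.2 (hu' f ⟨hf, hxf⟩ ▸ hfA))).elim
      · exact hu f ⟨hf, hxf⟩
  -- Enclosed edges have both ends in `D ∩ D'`, so nothing changes at `x`.
  · have hnA : ∀ f, x ∈ f.1 → f ∉ A := fun f hf hfA => hx' (mem_of_mem_enclosedEdges hfA hf).2
    refine ⟨e, ⟨Or.inr ⟨hnA e hxe, he⟩, hxe⟩, ?_⟩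
    rintro f ⟨⟨hfA, -⟩ | ⟨-, hf⟩, hxf⟩
    · exact (hnA f hxf hfA).elim
    · exact hu f ⟨hf, hxf⟩

/-- Normalized heights on `D` and `D'` which stay within `K` of each other on the boundary of
`D ∩ D'`. -/
structure HeightPair (G : PlaneBipartiteGraph V) (ref : G.Edge → ℝ) (D D' : Set V) (K : ℝ)
    (h h' : G.Config → ℂ → ℝ) : Prop where
  left : G.IsNormalizedHeight ref D h
  right : G.IsNormalizedHeight ref D' h'
  bound : ∀ M M', G.IsDimer D M → G.IsDimer D' M' →
    ∀ z, G.IsBoundaryFace (D ∩ D') z → |h' M' z - h M z| ≤ K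

/-- The edges enclosed by the faces where the two heights are close. -/
def gapEdges (G : PlaneBipartiteGraph V) (D D' : Set V) (K : ℝ) (h h' : G.Config → ℂ → ℝ)
    (M M' : G.Config) : Set G.Edge :=
  G.enclosedEdges (D ∩ D') fun z => |h' M' z - h M z| ≤ K

/-! ### The gap of the heights and its behaviour under the exchange -/

namespace HeightPair

variable {ref : G.Edge → ℝ} {D D' : Set V} {K : ℝ} {h h' : G.Config → ℂ → ℝ}

lemma symm (hp : G.HeightPair ref D D' K h h') : G.HeightPair ref D' D K h' h where
  left := hp.right
  right := hp.left
  bound M M' hM hM' z hz := by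
    rw [abs_sub_comm]
    exact hp.bound M' M hM' hM z (by rwa [Set.inter_comm])

variable {M M' : G.Config}

lemma gapEdges_symm : G.gapEdges D' D K h' h M' M = G.gapEdges D D' K h h' M M' := by
  unfold gapEdges
  rw [Set.inter_comm]
  simp only [abs_sub_comm]

lemma faceConst (hp : G.HeightPair ref D D' K h h') (hM : G.IsDimer D M) (hM' : G.IsDimer D' M') :
    G.FaceConst fun z => |h' M' z - h M z| ≤ K := by
  intro z z' hz
  simp only [(hp.left.1 M hM).1 z z' hz, (hp.right.1 M' hM').1 z z' hz]

lemma low_of_explored (hp : G.HeightPair ref D D' K h h') (hM : G.IsDimer D M)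
    (hM' : G.IsDimer D' M') (z : ℂ)
    (hz : G.Explored (D ∩ D') (fun z => |h' M' z - h M z| ≤ K) z) : |h' M' z - h M z| ≤ K := by
  cases hz with
  | base hz => exact hp.bound M M' hM hM' z hz
  | step _ _ hz => exact hz

lemma gap_sub (hp : G.HeightPair ref D D' K h h') (hM : G.IsDimer D M) (hM' : G.IsDimer D' M')
    {u v : V} (huv : G.graph.Adj u v) (hE : u ∈ D ∩ D' ∨ v ∈ D ∩ D') {z z' : ℂ}
    (hz : G.OnLeft u v z) (hz' : G.OnLeft v u z') :
    (h' M' z - h M z) - (h' M' z' - h M z') =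
      G.orient u * (ind M' ⟨s(u, v), huv⟩ - ind M ⟨s(u, v), huv⟩) := by
  have h1 := (hp.left.1 M hM).sub_eq huv (hE.imp And.left And.left) hz hz'
  have h2 := (hp.right.1 M' hM').sub_eq huv (hE.imp And.right And.right) hz hz'
  linarith

/-- The gap of the heights changes by at most one between adjacent faces. -/
lemma gap_step (hp : G.HeightPair ref D D' K h h') (hM : G.IsDimer D M) (hM' : G.IsDimer D' M')
    {z z' : ℂ} (hadj : G.AdjacentFaces (D ∩ D') z z') :
    ∃ k : ℤ, (h' M' z - h M z) - (h' M' z' - h M z') = k ∧ |(k : ℝ)| ≤ 1 := by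
  obtain ⟨u, v, huv, hE, hz, hz'⟩ := hadj
  rw [hp.gap_sub hM hM' huv hE hz hz']
  rcases ind_eq_zero_or_one M' ⟨s(u, v), huv⟩ with h1 | h1 <;>
  rcases ind_eq_zero_or_one M ⟨s(u, v), huv⟩ with h2 | h2 <;>
  rcases orient_eq (G := G) u with h3 | h3 <;> rw [h1, h2, h3]
  · exact ⟨0, by norm_num, by norm_num⟩
  · exact ⟨0, by norm_num, by norm_num⟩
  · exact ⟨-1, by norm_num, by norm_num⟩
  · exact ⟨1, by norm_num, by norm_num⟩
  · exact ⟨1, by norm_num, by norm_num⟩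
  · exact ⟨-1, by norm_num, by norm_num⟩
  · exact ⟨0, by norm_num, by norm_num⟩
  · exact ⟨0, by norm_num, by norm_num⟩

lemma isDimer_swap (hp : G.HeightPair ref D D' K h h') (hM : G.IsDimer D M)
    (hM' : G.IsDimer D' M') : G.IsDimer D (swapOn (G.gapEdges D D' K h h' M M') M M') := by
  refine hM.swapOn_enclosedEdges hM' (hp.faceConst hM hM') (hp.low_of_explored hM hM') ?_
  intro u v huv hu h1 h2 z z' hz hz'
  have := hp.gap_sub hM hM' huv (Or.inl hu) hz hz'
  have h3 : h' M' z - h M z = h' M' z' - h M z' := by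
    rw [ind_congr (M := M') (N := M) (by simp [h1, h2])] at this
    linarith
  simp only [h3]

lemma isDimer_swap' (hp : G.HeightPair ref D D' K h h') (hM : G.IsDimer D M)
    (hM' : G.IsDimer D' M') : G.IsDimer D' (swapOn (G.gapEdges D D' K h h' M M') M' M) := by
  have := hp.symm.isDimer_swap hM' hM
  rwa [gapEdges_symm] at this

/-- The reference flow cancels between the two configurations on `D`, so only exchanged edges can
alter the change of height. -/
lemma height_sub_of_notMem (hn : G.IsNormalizedHeight ref D h) {A : Set G.Edge} {N : G.Config}
    (hM : G.IsDimer D M) (hM₁ : G.IsDimer D (swapOn A M N)) {u v : V} (huv : G.graph.Adj u v)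
    (hD : u ∈ D ∨ v ∈ D) {z z' : ℂ} (hz : G.OnLeft u v z) (hz' : G.OnLeft v u z')
    (hA : ⟨s(u, v), huv⟩ ∉ A) :
    h (swapOn A M N) z - h M z = h (swapOn A M N) z' - h M z' := by
  have h1 := (hn.1 _ hM).sub_eq huv hD hz hz'
  have h2 := (hn.1 _ hM₁).sub_eq huv hD hz hz'
  rw [ind_congr (mem_swapOn_of_notMem hA)] at h2
  linarith

lemma height_sub_of_mem (hn : G.IsNormalizedHeight ref D h) {A : Set G.Edge} {N : G.Config}
    (hM : G.IsDimer D M) (hM₁ : G.IsDimer D (swapOn A M N)) {u v : V} (huv : G.graph.Adj u v)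
    (hD : u ∈ D ∨ v ∈ D) {z z' : ℂ} (hz : G.OnLeft u v z) (hz' : G.OnLeft v u z')
    (hA : ⟨s(u, v), huv⟩ ∈ A) :
    (h (swapOn A M N) z - h M z) - (h (swapOn A M N) z' - h M z') =
      G.orient u * (ind N ⟨s(u, v), huv⟩ - ind M ⟨s(u, v), huv⟩) := by
  have h1 := (hn.1 _ hM).sub_eq huv hD hz hz'
  have h2 := (hn.1 _ hM₁).sub_eq huv hD hz hz'
  rw [ind_congr (mem_swapOn_of_mem hA)] at h2
  linarith

/-- Two faces at the border of the enclosed region have the same gap if the change of the gap under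
the exchange reflects the gap between them. -/
lemma gap_eq_of_reflection {K a b p q : ℝ} {k : ℤ} (ha : |a| ≤ 2 * K) (hb : |b| ≤ 2 * K)
    (hp : K < |p|) (hp' : |p| ≤ K + 1) (hq : K < |q|) (hq' : |q| ≤ K + 1)
    (h : a + 2 * p = b + 2 * q) (hk : p - q = k) : p = q := by
  rw [abs_le] at ha hb
  have hk0 : k = 0 := by
    -- If `p` and `q` have the same sign, both absolute values lie in `(K, K + 1]` and the integer
    -- `p - q` is zero. Opposite signs would give `2 |p - q| > 4 K`, against `|a - b| ≤ 4 K`.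
    have h1 : |(k : ℝ)| < 1 := by
      rw [← hk, abs_lt]
      rcases le_or_gt 0 p with h1 | h1 <;> rcases le_or_gt 0 q with h2 | h2
      · rw [abs_of_nonneg h1] at hp hp'
        rw [abs_of_nonneg h2] at hq hq'
        constructor <;> linarith
      · rw [abs_of_nonneg h1] at hp hp'
        rw [abs_of_neg h2] at hq hq'
        linarith
      · rw [abs_of_neg h1] at hp hp'
        rw [abs_of_nonneg h2] at hq hq'
        linarith
      · rw [abs_of_neg h1] at hp hp'
        rw [abs_of_neg h2] at hq hq'
        constructor <;> linarith
    have h2 : |k| < 1 := by exact_mod_cast h1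
    exact Int.abs_lt_one_iff.1 h2
  rw [hk0, Int.cast_zero] at hk
  linarith

/-- The heights of the exchanged configurations are unchanged on the explored faces and on the
enclosed faces which are adjacent to them. -/
lemma height_swap_eq (hp : G.HeightPair ref D D' K h h') (hM : G.IsDimer D M)
    (hM' : G.IsDimer D' M') {z : ℂ}
    (hz : G.Explored (D ∩ D') (fun z => |h' M' z - h M z| ≤ K) z ∨
      ∃ t, G.Explored (D ∩ D') (fun z => |h' M' z - h M z| ≤ K) t ∧
        G.AdjacentFaces (D ∩ D') t z) :
    h (swapOn (G.gapEdges D D' K h h' M M') M M') z = h M z := by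
  set A := G.gapEdges D D' K h h' M M' with hA
  set E := D ∩ D' with hE
  set Q : ℂ → Prop := fun z => |h' M' z - h M z| ≤ K with hQdef
  set g : ℂ → ℝ := fun z => h' M' z - h M z with hg
  have hM₁ : G.IsDimer D (swapOn A M M') := hp.isDimer_swap hM hM'
  have hM₁' : G.IsDimer D' (swapOn A M' M) := hp.isDimer_swap' hM hM'
  have hQ : G.FaceConst Q := hp.faceConst hM hM'
  have hlow : ∀ z, G.Explored E Q z → |g z| ≤ K := hp.low_of_explored hM hM'
  set u : ℂ → ℝ := fun z => h (swapOn A M M') z - h M z with hu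
  set u' : ℂ → ℝ := fun z => h' (swapOn A M' M) z - h' M' z with hu'
  have hstep : ∀ y y', G.AdjacentFaces D y y' → ¬ (G.Enclosed E Q y ∧ G.Enclosed E Q y') →
      u y = u y' := by
    rintro y y' ⟨a, b, hab, hD, hy, hy'⟩ hne
    exact height_sub_of_notMem hp.left hM hM₁ hab hD hy hy' fun hmem =>
      hne ((mem_enclosedEdges_iff hQ hab hy hy').1 hmem)
  have hstep' : ∀ y y', G.AdjacentFaces E y y' → ¬ (G.Enclosed E Q y ∧ G.Enclosed E Q y') →
      u' y = u' y' := by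
    rintro y y' ⟨a, b, hab, hD, hy, hy'⟩ hne
    exact height_sub_of_notMem hp.right hM' hM₁' hab (hD.imp And.right And.right) hy hy' fun hmem =>
      hne ((mem_enclosedEdges_iff hQ hab hy hy').1 hmem)
  have hmono : ∀ y y', G.AdjacentFaces E y y' → G.AdjacentFaces D y y' := by
    rintro y y' ⟨a, b, hab, hD, hy, hy'⟩
    exact ⟨a, b, hab, hD.imp And.left And.left, hy, hy'⟩
  -- Inside the enclosed region `h` takes over the increments of `h'` and conversely. Thus `u - g`
  -- and `(u' - u) + 2 * g` are constant there: the gap is reflected.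
  have hinside : ∀ y y', G.AdjacentFaces D y y' → G.Enclosed E Q y → G.Enclosed E Q y' →
      u y - u y' = g y - g y' ∧ u' y - u' y' = -(g y - g y') ∧ G.AdjacentFaces E y y' := by
    rintro y y' ⟨a, b, hab, hD, hy, hy'⟩ hS hS'
    have hmem := (mem_enclosedEdges_iff hQ hab hy hy').2 ⟨hS, hS'⟩
    have haE : a ∈ E := hS.mem_of_mem_closure (hy.left_mem hab)
    have h1 := height_sub_of_mem hp.left hM hM₁ hab hD hy hy' hmem
    have h2 := height_sub_of_mem hp.right hM' hM₁' hab (Or.inl haE.2) hy hy' hmem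
    have h3 := hp.gap_sub hM hM' hab (Or.inl haE) hy hy'
    refine ⟨?_, ?_, a, b, hab, Or.inl haE, hy, hy'⟩
    · simp only [hu, hg]; linarith
    · simp only [hu', hg]; linarith
  -- `u' - u` is the change of the gap
  have hdelta : ∀ y, G.Explored E Q y → |u' y - u y| ≤ 2 * K := by
    intro y hy
    -- On boundary faces the gaps before and after the exchange are both at most `K`, whence `2 *
    -- K`. The exploration never crosses an exchanged edge, so this change of the gap is carried
    -- along.
    induction hy with
    | base hy =>
      have h1 := abs_le.1 (hp.bound _ _ hM hM' _ hy)
      have h2 := abs_le.1 (hp.bound _ _ hM₁ hM₁' _ hy)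
      simp only [hu, hu', abs_le]
      constructor <;> linarith [h1.1, h1.2, h2.1, h2.2]
    | step hy hadj _ ih =>
      rw [← hstep _ _ (hmono _ _ hadj) fun hh => hh.1.2 hy, ← hstep' _ _ hadj fun hh => hh.1.2 hy]
      exact ih
  have htouch : ∀ t c, G.Explored E Q t → G.AdjacentFaces E t c → G.Enclosed E Q c →
      |u' c - u c| ≤ 2 * K ∧ K < |g c| ∧ |g c| ≤ K + 1 := by
    intro t c ht hadj hc
    refine ⟨?_, ?_, ?_⟩
    · rw [← hstep _ _ (hmono _ _ hadj) fun hh => hh.1.2 ht, ← hstep' _ _ hadj fun hh => hh.1.2 ht]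
      exact hdelta t ht
    · by_contra hle
      exact hc.2 (ht.step hadj (not_lt.1 hle))
    · obtain ⟨k, hk, hk1⟩ := hp.gap_step hM hM' hadj
      have : g c = g t - k := by simp only [hg]; linarith
      rw [this]
      linarith [abs_sub (g t) k, hlow t ht]
  have hfaceD : G.IsFaceOf D z := by
    have : G.IsFaceOf E z := by
      rcases hz with hz | ⟨t, -, hadj⟩
      · exact hz.isFaceOf
      · exact hadj.symm.isFaceOf
    exact ⟨this.1, this.2.imp fun v hv => ⟨hv.1.1, hv.2⟩⟩
  -- The normalization gives `u b = 0` at a boundary face of `D`; the value of `u` is followed along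
  -- a path from `b` to `z`, which may leave `D ∩ D'`.
  obtain ⟨b, hb, hpath, hbeq⟩ := hp.left.2 z hfaceD
  have hpath' : Relation.ReflTransGen (G.AdjacentFaces D) b z :=
    have : Std.Symm (G.AdjacentFaces D) := ⟨fun _ _ h => h.symm⟩
    Std.Symm.symm _ _ hpath
  -- Outside the enclosed region `u` vanishes. Inside, `c` is the face through which the path last
  -- entered, and `u` is the gap accumulated since then.
  have inv : ∀ w, Relation.ReflTransGen (G.AdjacentFaces D) b w →
      (¬ G.Enclosed E Q w ∧ u w = 0) ∨ (G.Enclosed E Q w ∧ ∃ t c, G.Explored E Q t ∧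
        G.AdjacentFaces E t c ∧ G.Enclosed E Q c ∧
        (u' w - u w) + 2 * g w = (u' c - u c) + 2 * g c ∧ (∃ k : ℤ, g w - g c = k) ∧
        u w = g w - g c) := by
    intro w hw
    induction hw with
    | refl =>
      left
      refine ⟨fun hS => ?_, ?_⟩
      · obtain ⟨v, hv, hvb⟩ := hb.2
        exact hv (hS.mem_of_mem_closure hvb).1
      · simp only [hu, hbeq _ _ hM₁ hM, sub_self]
    | @tail w w' _ hadj ih =>
      by_cases hS' : G.Enclosed E Q w'
      · right
        refine ⟨hS', ?_⟩
        rcases ih with ⟨hS, hu0⟩ | ⟨hS, t, c, ht, hadjc, hc, href, ⟨k, hk⟩, huc⟩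
        · have hadjE : G.AdjacentFaces E w w' := by
            obtain ⟨a, b, hab, hD, hy, hy'⟩ := hadj
            exact ⟨a, b, hab, Or.inl (hS'.mem_of_mem_closure (hy'.right_mem hab.symm)), hy, hy'⟩
          have hT : G.Explored E Q w := by
            by_contra hT
            exact hS ⟨hadjE.isFaceOf, hT⟩
          refine ⟨w, w', hT, hadjE, hS', rfl, ⟨0, by simp⟩, ?_⟩
          rw [← hstep w w' hadj fun hh => hS hh.1, hu0, sub_self]
        · obtain ⟨h1, h2, hadjE⟩ := hinside w w' hadj hS hS'
          obtain ⟨j, hj, -⟩ := hp.gap_step hM hM' hadjE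
          refine ⟨t, c, ht, hadjc, hc, by linarith, ⟨k - j, ?_⟩, by linarith⟩
          have hj' : g w - g w' = j := hj
          push_cast
          linarith
      · left
        refine ⟨hS', ?_⟩
        rw [← hstep w w' hadj fun hh => hS' hh.2]
        rcases ih with ⟨hS, hu0⟩ | ⟨hS, t, c, ht, hadjc, hc, href, ⟨k, hk⟩, huc⟩
        · exact hu0
        · have hadjE : G.AdjacentFaces E w w' := by
            obtain ⟨a, b, hab, hD, hy, hy'⟩ := hadj
            exact ⟨a, b, hab, Or.inl (hS.mem_of_mem_closure (hy.left_mem hab)), hy, hy'⟩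
          have hT : G.Explored E Q w' := by
            by_contra hT
            exact hS' ⟨hadjE.symm.isFaceOf, hT⟩
          -- The path leaves the region at `w`. Both `c` and `w` touch explored faces, so the
          -- reflection argument gives `g w = g c`, even if they lie on different borders.
          obtain ⟨h1, h2, h3⟩ := htouch t c ht hadjc hc
          obtain ⟨h1', h2', h3'⟩ := htouch w' w hT hadjE.symm hS
          rw [huc, gap_eq_of_reflection h1' h1 h2' h3' h2 h3 href hk, sub_self]
  have huz : u z = 0 := by
    rcases inv z hpath' with ⟨-, h0⟩ | ⟨hS, t, c, ht, hadjc, hc, href, ⟨k, hk⟩, huc⟩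
    · exact h0
    · rcases hz with hz | ⟨t', ht', hadj⟩
      · exact (hS.2 hz).elim
      · obtain ⟨h1, h2, h3⟩ := htouch t c ht hadjc hc
        obtain ⟨h1', h2', h3'⟩ := htouch t' z ht' hadj hS
        rw [huc, gap_eq_of_reflection h1' h1 h2' h3' h2 h3 href hk, sub_self]
  exact sub_eq_zero.1 huz

/-- The exchange does not change the enclosed edges. -/
lemma gapEdges_swap (hp : G.HeightPair ref D D' K h h') (hM : G.IsDimer D M)
    (hM' : G.IsDimer D' M') :
    G.gapEdges D D' K h h' (swapOn (G.gapEdges D D' K h h' M M') M M')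
      (swapOn (G.gapEdges D D' K h h' M M') M' M) = G.gapEdges D D' K h h' M M' := by
  set A := G.gapEdges D D' K h h' M M' with hA
  set Q : ℂ → Prop := fun z => |h' M' z - h M z| ≤ K with hQ
  set Q₁ : ℂ → Prop := fun z => |h' (swapOn A M' M) z - h (swapOn A M M') z| ≤ K with hQ₁
  have key : ∀ z, (G.Explored (D ∩ D') Q z ∨ ∃ t, G.Explored (D ∩ D') Q t ∧
      G.AdjacentFaces (D ∩ D') t z) → (Q₁ z ↔ Q z) := by
    intro z hz
    have h1 := hp.height_swap_eq hM hM' hz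
    have h2 := hp.symm.height_swap_eq hM' hM (z := z) (by
      simp only [hQ, Set.inter_comm D', abs_sub_comm (h M _)] at hz ⊢
      exact hz)
    rw [gapEdges_symm] at h2
    simp only [hQ₁, hQ]
    rw [h1, h2]
  -- The exploration only tests explored faces and their neighbours, where the gap is unchanged;
  -- hence it takes the same course.
  have hex : ∀ z, G.Explored (D ∩ D') Q₁ z ↔ G.Explored (D ∩ D') Q z := by
    intro z
    constructor
    · intro hz
      induction hz with
      | base hz => exact .base hz
      | step _ hadj hz ih => exact ih.step hadj ((key _ (Or.inr ⟨_, ih, hadj⟩)).1 hz)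
    · intro hz
      induction hz with
      | base hz => exact .base hz
      | step hz0 hadj hz ih =>
        exact ih.step hadj ((key _ (Or.inl (hz0.step hadj hz))).2 hz)
  simp only [gapEdges, enclosedEdges, Enclosed, hA]
  change {e : G.Edge | ∀ u v, e.1 = s(u, v) → ∀ z, G.OnLeft u v z →
    G.IsFaceOf (D ∩ D') z ∧ ¬ G.Explored (D ∩ D') Q₁ z} = _
  simp only [hex]
  rfl

end HeightPair

end PlaneBipartiteGraph

namespace PlaneBipartiteGraph

variable {V : Type*} {G : PlaneBipartiteGraph V}

/-! ### A large gap at the origin encloses a given finite set of edges -/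

/-- The existence of `n`, uniform in the domains and configurations, is a property of the face of
`z`. It holds at `o` with `n = 0`, and crossing an edge costs one, so it spreads to all faces by
connectedness of the plane. -/
lemma exists_gap_enclosed (ref : G.Edge → ℝ) {o : ℂ} (ho : o ∉ G.skeleton) {z : ℂ}
    (hz : z ∉ G.skeleton) : ∃ n : ℕ, ∀ (D D' : Set V) (K : ℝ) (h h' : G.Config → ℂ → ℝ)
      (M M' : G.Config), G.HeightPair ref D D' K h h' → G.IsDimer D M → G.IsDimer D' M' →
      G.IsFaceOf (D ∩ D') o → K + n < |h' M' o - h M o| →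
      G.Enclosed (D ∩ D') (fun z => |h' M' z - h M z| ≤ K) z ∧
        |h' M' o - h M o| - n ≤ |h' M' z - h M z| := by
  set P : ℂ → Prop := fun z => ∃ n : ℕ, ∀ (D D' : Set V) (K : ℝ) (h h' : G.Config → ℂ → ℝ)
      (M M' : G.Config), G.HeightPair ref D D' K h h' → G.IsDimer D M → G.IsDimer D' M' →
      G.IsFaceOf (D ∩ D') o → K + n < |h' M' o - h M o| →
      G.Enclosed (D ∩ D') (fun z => |h' M' z - h M z| ≤ K) z ∧
        |h' M' o - h M o| - n ≤ |h' M' z - h M z| with hPdef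
  have hPc : ∀ z, ∀ z' ∈ G.face z, P z → P z' := by
    rintro z z' hz ⟨n, hn⟩
    refine ⟨n, fun D D' K h h' M M' hp hM hM' hf hlt => ?_⟩
    obtain ⟨h1, h2⟩ := hn D D' K h h' M M' hp hM hM' hf hlt
    refine ⟨(faceConst_enclosed (hp.faceConst hM hM') z z' hz).2 h1, ?_⟩
    rwa [(hp.left.1 M hM).1 z z' hz, (hp.right.1 M' hM').1 z z' hz]
  have hP : G.FaceConst P := fun z z' hz => ⟨hPc _ _ (mem_face_symm hz), hPc _ _ hz⟩
  have hcross : ∀ u v, G.graph.Adj u v → ∀ z z', G.OnLeft u v z → G.OnLeft v u z' → P z → P z' := by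
    rintro u v huv z z' hz hz' ⟨n, hn⟩
    refine ⟨n + 1, fun D D' K h h' M M' hp hM hM' hf hlt => ?_⟩
    push_cast at hlt ⊢
    obtain ⟨h1, h2⟩ := hn D D' K h h' M M' hp hM hM' hf (by linarith)
    have hadj : G.AdjacentFaces (D ∩ D') z z' :=
      ⟨u, v, huv, Or.inl (h1.mem_of_mem_closure (hz.left_mem huv)), hz, hz'⟩
    obtain ⟨k, hk, hk1⟩ := hp.gap_step hM hM' hadj
    have h3 : |h' M' z - h M z| ≤ |h' M' z' - h M z'| + 1 := by
      have : h' M' z - h M z = (h' M' z' - h M z') + k := by linarith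
      rw [this]
      linarith [abs_add_le (h' M' z' - h M z') k]
    refine ⟨⟨hadj.symm.isFaceOf, fun hT => ?_⟩, by linarith⟩
    linarith [hp.low_of_explored hM hM' z' hT]
  have h0 : P o := by
    refine ⟨0, fun D D' K h h' M M' hp hM hM' hf hlt => ?_⟩
    push_cast at hlt ⊢
    refine ⟨⟨hf, fun hT => ?_⟩, by linarith⟩
    linarith [hp.low_of_explored hM hM' _ hT]
  exact (hP.iff_of_isOpen isPreconnected_univ isOpen_univ (fun u v huv _ z z' hz hz' =>
    ⟨hcross u v huv z z' hz hz', hcross v u huv.symm z' z hz' hz⟩) (Set.mem_univ o) (Set.mem_univ z)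
    ho hz).1 h0

lemma exists_gap_subset_gapEdges (ref : G.Edge → ℝ) {o : ℂ} (ho : o ∉ G.skeleton) {W : Set G.Edge}
    (hW : W.Finite) : ∃ n : ℕ, ∀ (D D' : Set V) (K : ℝ) (h h' : G.Config → ℂ → ℝ)
      (M M' : G.Config), G.HeightPair ref D D' K h h' → G.IsDimer D M → G.IsDimer D' M' →
      G.IsFaceOf (D ∩ D') o → K + n < |h' M' o - h M o| → W ⊆ G.gapEdges D D' K h h' M M' := by
  induction W, hW using Set.Finite.induction_on with
  | empty => exact ⟨0, fun _ _ _ _ _ _ _ _ _ _ _ _ => Set.empty_subset _⟩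
  | insert _ _ ih =>
    rename_i e W _ _
    obtain ⟨n, hn⟩ := ih
    obtain ⟨u, v, huv, rfl⟩ := G.exists_edge_eq e
    obtain ⟨z, hz⟩ := exists_onLeft huv
    obtain ⟨z', hz'⟩ := exists_onLeft huv.symm
    obtain ⟨n₁, hn₁⟩ := exists_gap_enclosed ref ho hz.1
    obtain ⟨n₂, hn₂⟩ := exists_gap_enclosed ref ho hz'.1
    refine ⟨max n (max n₁ n₂), fun D D' K h h' M M' hp hM hM' hf hlt => ?_⟩
    push_cast at hlt
    have h1 := le_max_left (n : ℝ) (max n₁ n₂)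
    have h2 := le_max_right (n : ℝ) (max n₁ n₂)
    have h3 := le_max_left (n₁ : ℝ) n₂
    have h4 := le_max_right (n₁ : ℝ) n₂
    refine Set.insert_subset ?_ (hn D D' K h h' M M' hp hM hM' hf (by linarith))
    exact (mem_enclosedEdges_iff (hp.faceConst hM hM') huv hz hz').2
      ⟨(hn₁ D D' K h h' M M' hp hM hM' hf (by linarith)).1,
        (hn₂ D D' K h h' M M' hp hM hM' hf (by linarith)).1⟩

/-! ### Resampling inside a disc -/

/-- `D` contains the disc of radius `R + 1`, and the endpoints of all edges which meet it. -/
structure Covers (G : PlaneBipartiteGraph V) (D : Set V) (R : ℝ) : Prop where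
  vertex : ∀ v, ‖G.pos v‖ ≤ R + 1 → v ∈ D
  edge : ∀ u v, G.graph.Adj u v →
    (segment ℝ (G.pos u) (G.pos v) ∩ Metric.closedBall 0 (R + 1)).Nonempty → u ∈ D

lemma exists_mem_face_annulus {w p q : ℂ} {R : ℝ} (hp : p ∈ G.face w) (hpR : ‖p‖ < R + 1)
    (hq : q ∈ G.face w) (hqR : R < ‖q‖) : ∃ y ∈ G.face w, R < ‖y‖ ∧ ‖y‖ < R + 1 := by
  by_cases hpR' : R < ‖p‖
  · exact ⟨p, hp, hpR', hpR⟩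
  obtain ⟨c, hc1, hc2⟩ : ∃ c, R < c ∧ c < min ‖q‖ (R + 1) :=
    exists_between (lt_min hqR (by linarith))
  rw [lt_min_iff] at hc2
  obtain ⟨y, hy, hyc⟩ := isPreconnected_connectedComponentIn.intermediate_value hp hq
    (continuous_norm.continuousOn) (show c ∈ Set.Icc ‖p‖ ‖q‖ from ⟨by linarith, hc2.1.le⟩)
  exact ⟨y, hy, by simpa only [hyc] using hc1, by simpa only [hyc] using hc2.2⟩

lemma exists_mem_face_of_closure {w p : ℂ} (hp : p ∈ closure (G.face w)) {U : Set ℂ}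
    (hU : IsOpen U) (hpU : p ∈ U) : ∃ y ∈ G.face w, y ∈ U := by
  obtain ⟨y, hyU, hy⟩ := mem_closure_iff.1 hp U hU hpU
  exact ⟨y, hy, hyU⟩

lemma isOpen_lt_norm (R : ℝ) : IsOpen {y : ℂ | R < ‖y‖} := isOpen_lt continuous_const continuous_norm

lemma isOpen_norm_lt (R : ℝ) : IsOpen {y : ℂ | ‖y‖ < R} := isOpen_lt continuous_norm continuous_const

section

variable {ref : G.Edge → ℝ} {D : Set V} {h : G.Config → ℂ → ℝ} {R : ℝ} {M N : G.Config}

lemma height_sub_eq_of_iff (hn : G.IsNormalizedHeight ref D h) (hM : G.IsDimer D M)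
    (hN : G.IsDimer D N) {u v : V} (huv : G.graph.Adj u v) (hD : u ∈ D ∨ v ∈ D) {z z' : ℂ}
    (hz : G.OnLeft u v z) (hz' : G.OnLeft v u z')
    (hiff : ⟨s(u, v), huv⟩ ∈ N ↔ ⟨s(u, v), huv⟩ ∈ M) : h N z - h M z = h N z' - h M z' := by
  have h1 := (hn.1 _ hM).sub_eq huv hD hz hz'
  have h2 := (hn.1 _ hN).sub_eq huv hD hz hz'
  rw [ind_congr hiff] at h2
  linarith

/-- Two configurations which agree outside a disc have heights which differ by a constant around
this disc. -/
lemma height_sub_eq_annulus (hn : G.IsNormalizedHeight ref D h) (hD : G.Covers D R) (hR : 0 < R)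
    (hM : G.IsDimer D M) (hN : G.IsDimer D N)
    (hMN : ∀ e, e ∉ G.edgesInside R → (e ∈ N ↔ e ∈ M)) {y y' : ℂ} (hy : R < ‖y‖)
    (hy1 : ‖y‖ < R + 1) (hy' : R < ‖y'‖) (hy1' : ‖y'‖ < R + 1) (hys : y ∉ G.skeleton)
    (hys' : y' ∉ G.skeleton) : h N y - h M y = h N y' - h M y' := by
  have hP : G.FaceConst fun x => h N x - h M x = h N y' - h M y' := by
    intro x x' hx
    simp only [(hn.1 M hM).1 x x' hx, (hn.1 N hN).1 x x' hx]
  refine (hP.iff_of_isOpen (isPreconnected_annulus R (R + 1) hR.le)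
    ((isOpen_lt_norm R).inter (isOpen_norm_lt (R + 1))) ?_ ⟨hy, hy1⟩ ⟨hy', hy1'⟩ hys hys').2 rfl
  rintro u v huv ⟨p, hp, hpR, hpR1⟩ z z' hz hz'
  have huD : u ∈ D := hD.edge u v huv ⟨p, hp, by simpa using hpR1.le⟩
  have hnot : (⟨s(u, v), huv⟩ : G.Edge) ∉ G.edgesInside R := by
    intro hin
    have : p ∈ Metric.closedBall (0 : ℂ) R := hin (by rwa [edgeSegment_mk])
    rw [mem_closedBall_zero_iff] at this
    exact absurd hpR (not_lt.2 this)
  simp only [height_sub_eq_of_iff hn hM hN huv (Or.inl huD) hz hz' (hMN _ hnot)]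

/-- Two configurations which agree outside a disc have the same heights around this disc. -/
lemma height_eq_annulus (hn : G.IsNormalizedHeight ref D h) (hD : G.Covers D R) (hR : 0 < R)
    (h0 : G.IsFaceOf D 0) (hM : G.IsDimer D M) (hN : G.IsDimer D N)
    (hMN : ∀ e, e ∉ G.edgesInside R → (e ∈ N ↔ e ∈ M)) {y : ℂ} (hy : R < ‖y‖)
    (hy1 : ‖y‖ < R + 1) (hys : y ∉ G.skeleton) : h N y = h M y := by
  by_contra hne
  obtain ⟨b, hb, hpath, hbeq⟩ := hn.2 0 h0
  have hpath' : Relation.ReflTransGen (G.AdjacentFaces D) b 0 :=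
    have : Std.Symm (G.AdjacentFaces D) := ⟨fun _ _ h => h.symm⟩
    Std.Symm.symm _ _ hpath
  -- Such a face meets the annulus, where the difference of the heights is a constant, nonzero by
  -- assumption.
  have hfar : ∀ w p q, p ∈ G.face w → ‖p‖ < R + 1 → q ∈ G.face w → R < ‖q‖ →
      h N w - h M w ≠ 0 := by
    intro w p q hp hpR hq hqR heq
    obtain ⟨x, hx, hx1, hx2⟩ := exists_mem_face_annulus hp hpR hq hqR
    have h1 := height_sub_eq_annulus hn hD hR hM hN hMN hy hy1 hx1 hx2 hys
      (notMem_skeleton_of_mem_face hx)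
    rw [(hn.1 M hM).1 w x hx, (hn.1 N hN).1 w x hx, heq] at h1
    exact hne (sub_eq_zero.1 h1)
  -- The face `b` has a vertex outside `D`, hence far away. A path from `b` cannot cross an edge
  -- inside the disc, since the face before it would meet the annulus; so the difference stays zero,
  -- which is impossible at the origin.
  have inv : ∀ w, Relation.ReflTransGen (G.AdjacentFaces D) b w →
      h N w - h M w = 0 ∧ ∃ q ∈ G.face w, R < ‖q‖ := by
    intro w hw
    induction hw with
    | refl =>
      obtain ⟨v, hv, hvb⟩ := hb.2
      have hvR : R < ‖G.pos v‖ := by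
        by_contra hle
        exact hv (hD.vertex v (by linarith))
      exact ⟨by rw [hbeq _ _ hN hM, sub_self], exists_mem_face_of_closure hvb (isOpen_lt_norm R) hvR⟩
    | tail _ hadj ih =>
      obtain ⟨u, v, huv, huD, hz, hz'⟩ := hadj
      obtain ⟨hw0, q, hq, hqR⟩ := ih
      by_cases hin : (⟨s(u, v), huv⟩ : G.Edge) ∈ G.edgesInside R
      · have huR : ‖G.pos u‖ < R + 1 := by
          have : G.pos u ∈ Metric.closedBall (0 : ℂ) R :=
            hin (by rw [edgeSegment_mk]; exact left_mem_segment _ _ _)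
          rw [mem_closedBall_zero_iff] at this
          linarith
        obtain ⟨p, hp, hpR⟩ := exists_mem_face_of_closure (hz.left_mem huv) (isOpen_norm_lt (R + 1)) huR
        exact (hfar _ p q hp hpR hq hqR hw0).elim
      · refine ⟨by rw [← height_sub_eq_of_iff hn hM hN huv huD hz hz' (hMN _ hin), hw0], ?_⟩
        obtain ⟨p, hp, hpR⟩ := Set.not_subset.1 hin
        rw [edgeSegment_mk, segment_symm] at hp
        rw [mem_closedBall_zero_iff, not_le] at hpR
        exact exists_mem_face_of_closure (hz'.segment_subset huv.symm hp) (isOpen_lt_norm R) hpR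
  obtain ⟨h1, q, hq, hqR⟩ := inv 0 hpath'
  exact hfar 0 0 q (mem_face_self h0.1) (by simp; linarith) hq hqR h1

/-- A height on a domain which covers a disc and a height on the whole plane have the same
increments in this disc if their configurations agree there. -/
lemma height_increment_eq (hn : G.IsNormalizedHeight ref D h) (hD : G.Covers D R) (hR : 0 < R)
    (h0 : (0 : ℂ) ∉ G.skeleton) (hM : G.IsDimer D M)
    (hMN : ∀ e : G.Edge, (G.edgeSegment e ∩ Metric.closedBall 0 (R + 1)).Nonempty → (e ∈ M ↔ e ∈ N))
    {H : ℂ → ℝ} (hH : G.IsHeight ref Set.univ N H) {y : ℂ} (hy : ‖y‖ < R + 1)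
    (hys : y ∉ G.skeleton) : H 0 - H y = h M 0 - h M y := by
  have hP : G.FaceConst fun x => H 0 - H x = h M 0 - h M x := by
    intro x x' hx
    simp only [(hn.1 M hM).1 x x' hx, hH.1 x x' hx]
  refine (hP.iff_of_isOpen (U := Metric.ball 0 (R + 1)) (convex_ball _ _).isPreconnected
    Metric.isOpen_ball ?_ (z := 0) (by simp; linarith) (by simpa using hy) h0 hys).1 (by simp)
  rintro u v huv ⟨p, hp, hpR⟩ z z' hz hz'
  have hmeet := Set.Nonempty.mono (Set.inter_subset_inter_right _ Metric.ball_subset_closedBall)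
    ⟨p, hp, hpR⟩
  have huD : u ∈ D := hD.edge u v huv hmeet
  have h1 := (hn.1 _ hM).sub_eq huv (Or.inl huD) hz hz'
  have h2 := hH.sub_eq huv (Or.inl trivial) hz hz'
  rw [ind_congr (hMN ⟨s(u, v), huv⟩ (by rwa [edgeSegment_mk]))] at h1
  have h3 : H z - H z' = h M z - h M z' := by rw [h1, h2]
  constructor <;> intro h4 <;> linarith

end

end PlaneBipartiteGraph

namespace PlaneBipartiteGraph

variable {V : Type*} {G : PlaneBipartiteGraph V}

/-! ### Finite sums over dimer configurations -/

variable (G) in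
lemma finite_edges_within (D : Finset V) : {e : G.Edge | ∀ v ∈ e.1, v ∈ D}.Finite := by
  refine (D.sym2.finite_toSet.preimage Subtype.val_injective.injOn).subset fun e he => ?_
  exact Finset.mem_sym2_iff.2 he

lemma IsDimer.finite {D : Finset V} {M : G.Config} (hM : G.IsDimer (D : Set V) M) : M.Finite :=
  (G.finite_edges_within D).subset fun e he v hv => hM.1 e he v hv

variable (G) in
lemma finite_isDimer (D : Finset V) : {M | G.IsDimer (D : Set V) M}.Finite :=
  (G.finite_edges_within D).finite_subsets.subset fun _ hM e he v hv => hM.1 e he v hv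

variable (G) in
/-- The finite set of dimer configurations on `D`. -/
noncomputable def dimers (D : Finset V) : Finset G.Config := (G.finite_isDimer D).toFinset

@[simp]
lemma mem_dimers {D : Finset V} {M : G.Config} : M ∈ G.dimers D ↔ G.IsDimer (D : Set V) M := by
  simp [dimers]

variable (G) in
/-- The product of the weights of the edges of `M`. -/
noncomputable def configWeight (M : G.Config) : ℝ := ∏ᶠ e ∈ M, G.weight e

lemma configWeight_pos (M : G.Config) : 0 < G.configWeight M :=
  finprod_mem_induction (0 < ·) one_pos (fun _ _ => mul_pos) fun e _ => G.weight_pos e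

lemma configWeight_inter_mul_sdiff {M : G.Config} (hM : M.Finite) (A : Set G.Edge) :
    G.configWeight (M ∩ A) * G.configWeight (M \ A) = G.configWeight M :=
  finprod_mem_inter_mul_sdiff A hM

lemma configWeight_swapOn_mul {M N : G.Config} (hM : M.Finite) (hN : N.Finite) (A : Set G.Edge) :
    G.configWeight (swapOn A M N) * G.configWeight (swapOn A N M) =
      G.configWeight M * G.configWeight N := by
  have hfin : ∀ M N : G.Config, M.Finite → N.Finite → (swapOn A M N).Finite := fun M N hM hN =>
    (hM.union hN).subset (by rintro e (h | h); exacts [Or.inr h.2, Or.inl h.2])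
  have h1 : ∀ M N : G.Config, swapOn A M N ∩ A = N ∩ A := by
    intro M N; ext e
    exact and_congr_left fun he => mem_swapOn_of_mem he
  have h2 : ∀ M N : G.Config, swapOn A M N \ A = M \ A := by
    intro M N; ext e
    exact and_congr_left fun he => mem_swapOn_of_notMem he
  rw [← configWeight_inter_mul_sdiff (hfin M N hM hN) A,
    ← configWeight_inter_mul_sdiff (hfin N M hN hM) A, ← configWeight_inter_mul_sdiff hM A,
    ← configWeight_inter_mul_sdiff hN A, h1, h1, h2, h2]
  ring

-- Countability makes single configurations measurable, so Dirac masses can be evaluated on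
-- arbitrary events and functions.
variable (G) in
lemma countable_edge : Countable G.Edge := by
  rw [← Set.countable_univ_iff]
  refine (Set.countable_iUnion fun n : ℕ => (G.finite_edges_meeting n).countable).mono fun e _ => ?_
  obtain ⟨u, v, h, rfl⟩ := G.exists_edge_eq e
  obtain ⟨n, hn⟩ := exists_nat_ge ‖G.pos u‖
  refine Set.mem_iUnion.2 ⟨n, G.pos u, ?_, by simpa using hn⟩
  rw [edgeSegment_mk]
  exact left_mem_segment _ _ _

lemma boltzmann_eq {S : Set G.Config} (hS : S.Finite) (wt : G.Config → ℝ) :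
    G.boltzmann S wt = (ENNReal.ofReal (∑ M ∈ hS.toFinset, wt M))⁻¹ •
      ∑ M ∈ hS.toFinset, ENNReal.ofReal (wt M) • Measure.dirac M := by
  have := hS.fintype
  rw [boltzmann, finsum_mem_eq_finite_toFinset_sum _ hS, Measure.sum_fintype]
  congr 1
  symm
  refine Finset.sum_bij' (fun M hM => ⟨M, hS.mem_toFinset.1 hM⟩) (fun M _ => M.1) ?_ ?_ ?_ ?_ ?_
  all_goals simp

open Classical in
lemma boltzmann_real {S : Set G.Config} (hS : S.Finite) {wt : G.Config → ℝ}
    (hwt : ∀ M, 0 < wt M) (E : Set G.Config) :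
    (G.boltzmann S wt).real E =
      (∑ M ∈ hS.toFinset with M ∈ E, wt M) / ∑ M ∈ hS.toFinset, wt M := by
  have := G.countable_edge
  have h0 : 0 ≤ ∑ M ∈ hS.toFinset, wt M := Finset.sum_nonneg fun M _ => (hwt M).le
  rw [boltzmann_eq hS, measureReal_def, Measure.smul_apply, Measure.finsetSum_apply, smul_eq_mul,
    ENNReal.toReal_mul, ENNReal.toReal_inv, ENNReal.toReal_ofReal h0, div_eq_inv_mul]
  congr 1
  rw [ENNReal.toReal_sum, Finset.sum_filter]
  · refine Finset.sum_congr rfl fun M _ => ?_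
    rw [Measure.smul_apply, Measure.dirac_apply, smul_eq_mul, ENNReal.toReal_mul,
      ENNReal.toReal_ofReal (hwt M).le]
    by_cases hM : M ∈ E <;> simp [hM]
  · intro M _
    rw [Measure.smul_apply, Measure.dirac_apply, smul_eq_mul]
    by_cases hM : M ∈ E <;> simp [hM]

lemma integral_boltzmann {S : Set G.Config} (hS : S.Finite) {wt : G.Config → ℝ}
    (hwt : ∀ M, 0 < wt M) (F : G.Config → ℝ) :
    ∫ M, F M ∂(G.boltzmann S wt) =
      (∑ M ∈ hS.toFinset, wt M * F M) / ∑ M ∈ hS.toFinset, wt M := by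
  have := G.countable_edge
  have h0 : 0 ≤ ∑ M ∈ hS.toFinset, wt M := Finset.sum_nonneg fun M _ => (hwt M).le
  rw [boltzmann_eq hS, integral_smul_measure, integral_finsetSum_measure]
  · rw [ENNReal.toReal_inv, ENNReal.toReal_ofReal h0, smul_eq_mul, div_eq_inv_mul]
    congr 1
    refine Finset.sum_congr rfl fun M _ => ?_
    rw [integral_smul_measure, integral_dirac, ENNReal.toReal_ofReal (hwt M).le, smul_eq_mul]
  · exact fun M _ => (integrable_dirac (by simp)).smul_measure ENNReal.ofReal_ne_top

lemma integral_dimerMeasure (D : Finset V) (F : G.Config → ℝ) :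
    ∫ M, F M ∂(G.dimerMeasure D) =
      (∑ M ∈ G.dimers D, G.configWeight M * F M) / ∑ M ∈ G.dimers D, G.configWeight M :=
  integral_boltzmann (G.finite_isDimer D) (fun M => configWeight_pos M) F

lemma isProbabilityMeasure_boltzmann {S : Set G.Config} (hS : S.Finite) (hne : S.Nonempty)
    {wt : G.Config → ℝ} (hwt : ∀ M, 0 < wt M) : IsProbabilityMeasure (G.boltzmann S wt) := by
  classical
  have h := boltzmann_real hS hwt Set.univ
  have hpos : 0 < ∑ M ∈ hS.toFinset, wt M :=
    Finset.sum_pos (fun M _ => hwt M) (by simpa using hne)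
  simp only [Set.mem_univ, Finset.filter_true, div_self hpos.ne'] at h
  constructor
  rw [measureReal_def] at h
  rwa [ENNReal.toReal_eq_one_iff] at h

/-! ### The law inside a disc given the configuration outside -/

/-- For gluing: the matching condition is checked at each vertex against whichever configuration is
in force there. The gluings below use one inside the disc and another outside. -/
lemma isDimer_of_local {D : Set V} {N : G.Config} (hN : ∀ e ∈ N, ∀ v ∈ e.1, v ∈ D)
    (h : ∀ x ∈ D, ∃ (D₁ : Set V) (M₁ : G.Config), G.IsDimer D₁ M₁ ∧ x ∈ D₁ ∧
      ∀ e : G.Edge, x ∈ e.1 → (e ∈ N ↔ e ∈ M₁)) : G.IsDimer D N := by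
  refine ⟨hN, fun x hx => ?_⟩
  obtain ⟨D₁, M₁, hM₁, hx₁, hiff⟩ := h x hx
  obtain ⟨e, ⟨he, hxe⟩, hu⟩ := hM₁.2 x hx₁
  exact ⟨e, ⟨(hiff e hxe).2 he, hxe⟩, fun f hf => hu f ⟨(hiff f hf.2).1 hf.1, hf.2⟩⟩

lemma pos_mem_edgeSegment {e : G.Edge} {v : V} (hv : v ∈ e.1) : G.pos v ∈ G.edgeSegment e := by
  obtain ⟨w, h, rfl⟩ := exists_edge_at e hv
  rw [edgeSegment_mk]
  exact left_mem_segment _ _ _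

lemma norm_pos_le_of_mem_edgesInside {R : ℝ} {e : G.Edge} (he : e ∈ G.edgesInside R) {v : V}
    (hv : v ∈ e.1) : ‖G.pos v‖ ≤ R := by
  simpa using he (pos_mem_edgeSegment hv)

variable (G) in
lemma finite_edgesInside (R : ℝ) : (G.edgesInside R).Finite := by
  refine (G.finite_edges_meeting R).subset fun e he => ?_
  obtain ⟨u, v, h, rfl⟩ := G.exists_edge_eq e
  have := pos_mem_edgeSegment (G := G) (e := ⟨s(u, v), h⟩) (Sym2.mem_mk_left u v)
  exact ⟨_, this, he this⟩

variable (G) in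
/-- The dimer configurations of the whole graph which agree with `m` outside a disc. -/
def resamplings (R : ℝ) (m : G.Config) : Set G.Config :=
  {M | G.IsDimer Set.univ M ∧ ∀ e, e ∉ G.edgesInside R → (e ∈ M ↔ e ∈ m)}

lemma finite_resamplings (R : ℝ) (m : G.Config) : (G.resamplings R m).Finite := by
  refine ((G.finite_edgesInside R).finite_subsets.image fun J => J ∪ (m \ G.edgesInside R)).subset ?_
  rintro M ⟨-, hM⟩
  refine ⟨M ∩ G.edgesInside R, Set.inter_subset_right, ?_⟩
  ext e
  by_cases he : e ∈ G.edgesInside R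
  · simp [he]
  · simp [he, hM e he]

variable (G) in
/-- Given the configuration `m` outside the disc of radius `R`, the height at the origin is in every
interval of length one with probability at most `ε`. -/
def SpreadAt (ref : G.Edge → ℝ) (R ε : ℝ) (m : G.Config) : Prop :=
  ∀ z, z ∉ G.skeleton → R < ‖z‖ → ∀ x : ℝ,
    (G.specification R m).real {M | ∀ H, G.IsHeight ref Set.univ M H →
      H 0 - H z ∈ Set.Ioo x (x + 1)} ≤ ε

/-- `M` agrees near the disc of radius `R` with a dimer configuration `m` of the whole graph whose
heights are spread out. -/
structure GoodNear (G : PlaneBipartiteGraph V) (ref : G.Edge → ℝ) (R ε : ℝ) (D : Set V)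
    (M m : G.Config) : Prop where
  covers : G.Covers D R
  dimer : G.IsDimer Set.univ m
  spread : G.SpreadAt ref R ε m
  agree : ∀ e : G.Edge, (G.edgeSegment e ∩ Metric.closedBall 0 (R + 1)).Nonempty → (e ∈ M ↔ e ∈ m)

section

variable {ref : G.Edge → ℝ} {D : Finset V} {h : G.Config → ℂ → ℝ} {R ε : ℝ} {M m : G.Config}

lemma sdiff_eq_iff {A : Set G.Edge} {M N : G.Config} :
    N \ A = M \ A ↔ ∀ e, e ∉ A → (e ∈ N ↔ e ∈ M) := by
  simp only [Set.ext_iff, Set.mem_sdiff, and_congr_left_iff]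

lemma GoodNear.agree_at (hg : G.GoodNear ref R ε D M m) {x : V} (hx : ‖G.pos x‖ ≤ R) {e : G.Edge}
    (hxe : x ∈ e.1) : e ∈ M ↔ e ∈ m :=
  hg.agree e ⟨_, pos_mem_edgeSegment hxe, by simp; linarith⟩

lemma GoodNear.isDimer_univ (hg : G.GoodNear ref R ε D M m) {N : G.Config}
    (hN : G.IsDimer (D : Set V) N) (hNM : ∀ e, e ∉ G.edgesInside R → (e ∈ N ↔ e ∈ M)) :
    G.IsDimer Set.univ (swapOn (G.edgesInside R) m N) := by
  refine isDimer_of_local (fun _ _ _ _ => trivial) fun x _ => ?_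
  by_cases hx : ‖G.pos x‖ ≤ R
  · refine ⟨D, N, hN, hg.covers.vertex x (by linarith), fun e hxe => ?_⟩
    by_cases he : e ∈ G.edgesInside R
    · exact mem_swapOn_of_mem he
    · rw [mem_swapOn_of_notMem he, ← hg.agree_at hx hxe, hNM e he]
  · refine ⟨Set.univ, m, hg.dimer, trivial, fun e hxe => mem_swapOn_of_notMem fun he => ?_⟩
    exact hx (norm_pos_le_of_mem_edgesInside he hxe)

lemma GoodNear.isDimer_domain (hg : G.GoodNear ref R ε D M m) (hM : G.IsDimer (D : Set V) M)
    {n : G.Config} (hn : n ∈ G.resamplings R m) :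
    G.IsDimer (D : Set V) (swapOn (G.edgesInside R) M n) := by
  refine isDimer_of_local ?_ fun x hxD => ?_
  · rintro e (⟨he, -⟩ | ⟨-, he⟩) v hv
    · exact hg.covers.vertex v (by linarith [norm_pos_le_of_mem_edgesInside he hv])
    · exact hM.1 e he v hv
  by_cases hx : ‖G.pos x‖ ≤ R
  · refine ⟨Set.univ, n, hn.1, trivial, fun e hxe => ?_⟩
    by_cases he : e ∈ G.edgesInside R
    · exact mem_swapOn_of_mem he
    · rw [mem_swapOn_of_notMem he, hg.agree_at hx hxe, hn.2 e he]
  · refine ⟨D, M, hM, hxD, fun e hxe => mem_swapOn_of_notMem fun he => ?_⟩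
    exact hx (norm_pos_le_of_mem_edgesInside he hxe)

open Classical in
/-- The resamplings of `M` in `D` correspond to those of `m` in the whole graph. -/
lemma GoodNear.sum_resamplings (hg : G.GoodNear ref R ε D M m) (hM : G.IsDimer (D : Set V) M)
    (f : G.Config → ℝ) :
    ∑ N ∈ G.dimers D with N \ G.edgesInside R = M \ G.edgesInside R,
        f (swapOn (G.edgesInside R) m N) =
      ∑ n ∈ (finite_resamplings R m).toFinset, f n := by
  have hswap : ∀ (M m N : G.Config), (∀ e, e ∉ G.edgesInside R → (e ∈ N ↔ e ∈ M)) →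
      swapOn (G.edgesInside R) M (swapOn (G.edgesInside R) m N) = N := by
    intro M m N h
    ext e
    by_cases he : e ∈ G.edgesInside R
    · rw [mem_swapOn_of_mem he, mem_swapOn_of_mem he]
    · rw [mem_swapOn_of_notMem he, h e he]
  refine Finset.sum_nbij' (fun N => swapOn (G.edgesInside R) m N)
    (fun n => swapOn (G.edgesInside R) M n) ?_ ?_ ?_ ?_ fun _ _ => rfl
  · intro N hN
    rw [Finset.mem_filter, mem_dimers, sdiff_eq_iff] at hN
    exact (Set.Finite.mem_toFinset _).2 ⟨hg.isDimer_univ hN.1 hN.2, fun e he => mem_swapOn_of_notMem he⟩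
  · intro n hn
    rw [Set.Finite.mem_toFinset] at hn
    rw [Finset.mem_filter, mem_dimers, sdiff_eq_iff]
    exact ⟨hg.isDimer_domain hM hn, fun e he => mem_swapOn_of_notMem he⟩
  · intro N hN
    rw [Finset.mem_filter, mem_dimers, sdiff_eq_iff] at hN
    exact hswap M m N hN.2
  · intro n hn
    rw [Set.Finite.mem_toFinset] at hn
    exact hswap m M n hn.2

/-- The outer factor is common to all resamplings of `M` and cancels against the normalization of
`specification`. -/
lemma configWeight_resampling {N : G.Config} (hN : G.IsDimer (D : Set V) N)
    (hNM : N \ G.edgesInside R = M \ G.edgesInside R) :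
    G.configWeight N = G.configWeight (M \ G.edgesInside R) *
      G.configWeight (swapOn (G.edgesInside R) m N ∩ G.edgesInside R) := by
  rw [← configWeight_inter_mul_sdiff hN.finite (G.edgesInside R), hNM, mul_comm]
  congr 2
  ext e
  exact and_congr_left fun he => (mem_swapOn_of_mem he).symm

open Classical in
/-- Given the configuration outside the disc, the increment of the height from a point near the
disc to the origin is spread out. -/
lemma GoodNear.sum_window_le (hg : G.GoodNear ref R ε D M m)
    (hn : G.IsNormalizedHeight ref (D : Set V) h)
    (h0 : (0 : ℂ) ∉ G.skeleton) (hR : 0 < R) (hM : G.IsDimer (D : Set V) M) {y : ℂ}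
    (hy : R < ‖y‖) (hy1 : ‖y‖ < R + 1) (hys : y ∉ G.skeleton) (x : ℝ) :
    ∑ N ∈ G.dimers D with N \ G.edgesInside R = M \ G.edgesInside R,
        (if h N 0 - h N y ∈ Set.Ioo x (x + 1) then G.configWeight N else 0) ≤
      ε * ∑ N ∈ G.dimers D with N \ G.edgesInside R = M \ G.edgesInside R, G.configWeight N := by
  set I := G.edgesInside R with hI
  set c := G.configWeight (M \ I) with hc
  have hc0 : 0 < c := configWeight_pos _
  set E : Set G.Config := {N | ∀ H, G.IsHeight ref Set.univ N H → H 0 - H y ∈ Set.Ioo x (x + 1)}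
    with hE
  set S := (finite_resamplings (G := G) R m).toFinset with hS
  have hne : S.Nonempty := ⟨m, (Set.Finite.mem_toFinset _).2 ⟨hg.dimer, fun _ _ => Iff.rfl⟩⟩
  have hpos : 0 < ∑ n ∈ S, G.configWeight (n ∩ I) :=
    Finset.sum_pos (fun n _ => configWeight_pos _) hne
  have hspec : (∑ n ∈ S with n ∈ E, G.configWeight (n ∩ I)) ≤
      ε * ∑ n ∈ S, G.configWeight (n ∩ I) := by
    have h1 := hg.spread y hys hy x
    have h2 := boltzmann_real (finite_resamplings (G := G) R m)
      (wt := fun N => G.configWeight (N ∩ I)) (fun N => configWeight_pos _) E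
    have h3 : G.specification R m = G.boltzmann (G.resamplings R m)
      (fun N => G.configWeight (N ∩ I)) := rfl
    rw [h3, h2, div_le_iff₀ hpos] at h1
    exact h1
  calc _ ≤ ∑ N ∈ G.dimers D with N \ I = M \ I,
        c * (if swapOn I m N ∈ E then G.configWeight (swapOn I m N ∩ I) else 0) := by
        refine Finset.sum_le_sum fun N hN => ?_
        rw [Finset.mem_filter, mem_dimers] at hN
        have hNM := sdiff_eq_iff.1 hN.2
        split_ifs with h1 h2 h2
        · exact (configWeight_resampling hN.1 hN.2).le
        -- By `height_increment_eq`, every height on the plane of the transplanted configuration has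
        -- the same increment from `y` to the origin as `h N`.
        · exfalso
          apply h2
          intro H hH
          rw [height_increment_eq hn hg.covers hR h0 hN.1 ?_ hH hy1 hys]
          · exact h1
          · intro e he
            by_cases heI : e ∈ I
            · rw [mem_swapOn_of_mem heI]
            · rw [mem_swapOn_of_notMem heI, hNM e heI, hg.agree e he]
        · exact (mul_pos hc0 (configWeight_pos _)).le
        · simp
    _ = c * ∑ n ∈ S with n ∈ E, G.configWeight (n ∩ I) := by
        rw [← Finset.mul_sum, Finset.sum_filter (fun n => n ∈ E)]
        congr 1
        exact hg.sum_resamplings hM fun n => if n ∈ E then G.configWeight (n ∩ I) else 0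
    _ ≤ c * (ε * ∑ n ∈ S, G.configWeight (n ∩ I)) := by gcongr
    _ = ε * ∑ N ∈ G.dimers D with N \ I = M \ I, G.configWeight N := by
        rw [← hg.sum_resamplings hM fun n => G.configWeight (n ∩ I), mul_left_comm, Finset.mul_sum]
        congr 1
        refine Finset.sum_congr rfl fun N hN => ?_
        rw [Finset.mem_filter, mem_dimers] at hN
        exact (configWeight_resampling hN.1 hN.2).symm

variable (G) in
lemma exists_mem_annulus (hR : 0 < R) : ∃ y : ℂ, R < ‖y‖ ∧ ‖y‖ < R + 1 ∧ y ∉ G.skeleton := by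
  obtain ⟨y, hy, hy'⟩ := G.dense_compl_skeleton.inter_open_nonempty _
    ((isOpen_lt_norm R).inter (isOpen_norm_lt (R + 1))) ⟨((R + 1 / 2 : ℝ) : ℂ), by
      have : |R + 1 / 2| = R + 1 / 2 := abs_of_pos (by linarith)
      constructor
      · change R < ‖((R + 1 / 2 : ℝ) : ℂ)‖
        rw [Complex.norm_real, Real.norm_eq_abs, this]; linarith
      · change ‖((R + 1 / 2 : ℝ) : ℂ)‖ < R + 1
        rw [Complex.norm_real, Real.norm_eq_abs, this]; linarith⟩
  exact ⟨y, hy.1, hy.2, hy'⟩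

/-- A closed interval of length `2 L` is covered by `⌊4 L⌋ + 1` open intervals of length one. -/
lemma exists_window {a b L : ℝ} (h : |b - a| ≤ L) : ∃ j ∈ Finset.range (⌊4 * L⌋₊ + 1),
    b ∈ Set.Ioo (a - L - 1 / 2 + j / 2) (a - L - 1 / 2 + j / 2 + 1) := by
  rw [abs_le] at h
  have h0 : 0 ≤ 2 * (b - a + L) := by linarith
  refine ⟨⌊2 * (b - a + L)⌋₊, ?_, ?_, ?_⟩
  · rw [Finset.mem_range, Nat.lt_succ_iff]
    exact Nat.floor_le_floor (by linarith)
  · linarith [Nat.floor_le h0]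
  · linarith [Nat.lt_floor_add_one (2 * (b - a + L))]

open Classical in
lemma GoodNear.sum_near_le (hg : G.GoodNear ref R ε D M m)
    (hn : G.IsNormalizedHeight ref (D : Set V) h)
    (h0 : G.IsFaceOf (D : Set V) 0) (hR : 0 < R) (hM : G.IsDimer (D : Set V) M) (t L : ℝ) :
    ∑ N ∈ G.dimers D with N \ G.edgesInside R = M \ G.edgesInside R,
        (if |t - h N 0| ≤ L then G.configWeight N else 0) ≤
      (⌊4 * L⌋₊ + 1) * ε *
        ∑ N ∈ G.dimers D with N \ G.edgesInside R = M \ G.edgesInside R, G.configWeight N := by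
  obtain ⟨y, hy, hy1, hys⟩ := G.exists_mem_annulus hR
  -- By `height_eq_annulus`, `h N y = h M y` for all resamplings `N`, so closeness of `h N 0` to `t`
  -- is a condition on the increment from `y`, covered by windows of length one.
  set a := t - h M y
  calc _ ≤ ∑ N ∈ G.dimers D with N \ G.edgesInside R = M \ G.edgesInside R,
        ∑ j ∈ Finset.range (⌊4 * L⌋₊ + 1), (if h N 0 - h N y ∈ Set.Ioo (a - L - 1 / 2 + j / 2)
          (a - L - 1 / 2 + j / 2 + 1) then G.configWeight N else 0) := by
        refine Finset.sum_le_sum fun N hN => ?_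
        rw [Finset.mem_filter, mem_dimers] at hN
        have hnonneg : ∀ j ∈ Finset.range (⌊4 * L⌋₊ + 1), (0 : ℝ) ≤
            (if h N 0 - h N y ∈ Set.Ioo (a - L - 1 / 2 + j / 2)
              (a - L - 1 / 2 + j / 2 + 1) then G.configWeight N else 0) := by
          intro j _
          split_ifs
          · exact (configWeight_pos N).le
          · exact le_rfl
        split_ifs with h1
        · have hNy := height_eq_annulus hn hg.covers hR h0 hM hN.1 (sdiff_eq_iff.1 hN.2) hy hy1 hys
          obtain ⟨j, hj, hj'⟩ := exists_window (a := a) (b := h N 0 - h N y) (L := L) (by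
            rw [hNy, abs_sub_comm]
            convert h1 using 2
            ring)
          refine le_trans ?_ (Finset.single_le_sum hnonneg hj)
          rw [if_pos hj']
        · exact Finset.sum_nonneg hnonneg
    _ ≤ ∑ j ∈ Finset.range (⌊4 * L⌋₊ + 1), ε * ∑ N ∈ G.dimers D with
          N \ G.edgesInside R = M \ G.edgesInside R, G.configWeight N := by
        rw [Finset.sum_comm]
        exact Finset.sum_le_sum fun j _ => hg.sum_window_le hn h0.1 hR hM hy hy1 hys _
    _ = _ := by
        rw [Finset.sum_const, Finset.card_range, nsmul_eq_mul]
        push_cast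
        ring

open Classical in
/-- The height at the origin is rarely near a given number when the configuration is good. -/
lemma sum_good_near_le {Good : G.Config → Prop}
    (hgood : ∀ M, G.IsDimer (D : Set V) M → Good M → ∃ m, G.GoodNear ref R ε D M m)
    (hε : 0 ≤ ε) (hn : G.IsNormalizedHeight ref (D : Set V) h)
    (h0 : G.IsFaceOf (D : Set V) 0) (hR : 0 < R) (t L : ℝ) :
    ∑ M ∈ G.dimers D, (if Good M ∧ |t - h M 0| ≤ L then G.configWeight M else 0) ≤
      (⌊4 * L⌋₊ + 1) * ε * ∑ M ∈ G.dimers D, G.configWeight M := by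
  -- Condition on the configuration outside the disc. One good configuration in a fibre gives the
  -- bound for the whole fibre; a fibre without any contributes zero.
  set κ : G.Config → G.Config := fun M => M \ G.edgesInside R with hκ
  have hmaps : ∀ M ∈ G.dimers D, κ M ∈ (G.dimers D).image κ := fun M hM =>
    Finset.mem_image_of_mem κ hM
  rw [← Finset.sum_fiberwise_of_maps_to hmaps, ← Finset.sum_fiberwise_of_maps_to hmaps,
    Finset.mul_sum]
  refine Finset.sum_le_sum fun c _ => ?_
  by_cases hex : ∃ M ∈ G.dimers D, κ M = c ∧ Good M
  · obtain ⟨M, hM, rfl, hMg⟩ := hex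
    rw [mem_dimers] at hM
    obtain ⟨m, hg⟩ := hgood M hM hMg
    refine le_trans (Finset.sum_le_sum fun N _ => ?_) (hg.sum_near_le hn h0 hR hM t L)
    split_ifs with h1 h2 h2
    · exact le_rfl
    · exact (h2 h1.2).elim
    · exact (configWeight_pos N).le
    · exact le_rfl
  · rw [Finset.sum_eq_zero]
    · exact mul_nonneg (mul_nonneg (by positivity) hε)
        (Finset.sum_nonneg fun M _ => (configWeight_pos M).le)
    · intro N hN
      rw [Finset.mem_filter] at hN
      exact if_neg fun h1 => hex ⟨N, hN.1, hN.2, h1.1⟩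

end

end PlaneBipartiteGraph

namespace PlaneBipartiteGraph

variable {V : Type*} {G : PlaneBipartiteGraph V}

/-! ### Comparison of the dimer measures on two domains -/

/-- `f` depends only on the edges of `W`. -/
def DependsOnEdges {α : Type*} (W : Set G.Edge) (f : G.Config → α) : Prop :=
  ∀ M N : G.Config, (∀ e ∈ W, (e ∈ M ↔ e ∈ N)) → f M = f N

section

variable {ref : G.Edge → ℝ} {D D' : Finset V} {K : ℝ} {h h' : G.Config → ℂ → ℝ}

open Classical in
/-- On the event that the edges of `W` are enclosed, the configurations on `D` and on `D'` have the
same law on `W`. -/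
lemma HeightPair.sum_exchange (hp : G.HeightPair ref D D' K h h') {W : Set G.Edge}
    {F : G.Config → ℝ} (hF : DependsOnEdges W F) :
    ∑ p ∈ G.dimers D ×ˢ G.dimers D' with W ⊆ G.gapEdges D D' K h h' p.1 p.2,
      G.configWeight p.1 * G.configWeight p.2 * (F p.2 - F p.1) = 0 := by
  set A : G.Config × G.Config → Set G.Edge := fun p => G.gapEdges D D' K h h' p.1 p.2 with hA
  have hmem : ∀ p ∈ {p ∈ G.dimers D ×ˢ G.dimers D' | W ⊆ A p},
      G.IsDimer (D : Set V) p.1 ∧ G.IsDimer (D' : Set V) p.2 ∧ W ⊆ A p := by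
    intro p hp
    simpa [and_assoc] using hp
  have hAswap : ∀ p ∈ {p ∈ G.dimers D ×ˢ G.dimers D' | W ⊆ A p},
      A (swapOn (A p) p.1 p.2, swapOn (A p) p.2 p.1) = A p := fun p hpm =>
    hp.gapEdges_swap (hmem p hpm).1 (hmem p hpm).2.1
  have hneg : ∀ p ∈ {p ∈ G.dimers D ×ˢ G.dimers D' | W ⊆ A p},
      G.configWeight p.1 * G.configWeight p.2 * (F p.2 - F p.1) +
      G.configWeight (swapOn (A p) p.1 p.2) * G.configWeight (swapOn (A p) p.2 p.1) *
        (F (swapOn (A p) p.2 p.1) - F (swapOn (A p) p.1 p.2)) = 0 := by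
    intro p hpm
    obtain ⟨h1, h2, h3⟩ := hmem p hpm
    rw [configWeight_swapOn_mul h1.finite h2.finite,
      hF (swapOn (A p) p.2 p.1) p.1 fun e he => mem_swapOn_of_mem (h3 he),
      hF (swapOn (A p) p.1 p.2) p.2 fun e he => mem_swapOn_of_mem (h3 he)]
    ring
  -- The exchange preserves the weights and the event, and swaps the two values of `F`, so the terms
  -- cancel in pairs and vanish at fixed pairs.
  refine Finset.sum_involution (fun p _ => (swapOn (A p) p.1 p.2, swapOn (A p) p.2 p.1)) hneg ?_ ?_ ?_
  · intro p hpm hne heq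
    have h1 := hneg p hpm
    have h2 : swapOn (A p) p.1 p.2 = p.1 := congrArg Prod.fst heq
    have h3 : swapOn (A p) p.2 p.1 = p.2 := congrArg Prod.snd heq
    rw [h2, h3] at h1
    exact hne (by linarith)
  · intro p hpm
    obtain ⟨h1, h2, h3⟩ := hmem p hpm
    refine Finset.mem_filter.2 ⟨Finset.mem_product.2 ⟨mem_dimers.2 (hp.isDimer_swap h1 h2),
      mem_dimers.2 (hp.isDimer_swap' h1 h2)⟩, ?_⟩
    change W ⊆ A _
    rw [hAswap p hpm]
    exact h3
  · intro p hpm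
    simp only
    rw [hAswap p hpm, swapOn_swapOn, swapOn_swapOn]

lemma sum_configWeight_pos {D : Finset V} (hex : ∃ M, G.IsDimer (D : Set V) M) :
    0 < ∑ M ∈ G.dimers D, G.configWeight M := by
  obtain ⟨M, hM⟩ := hex
  exact Finset.sum_pos (fun M _ => configWeight_pos M) ⟨M, mem_dimers.2 hM⟩

open Classical in
/-- The laws of the edges of `W` are close if the height at the origin is spread out. -/
lemma HeightPair.abs_integral_sub_le (hp : G.HeightPair ref D D' K h h') {W : Set G.Edge}
    {F : G.Config → ℝ} (hF : DependsOnEdges W F) {C : ℝ} (hC : ∀ M, |F M| ≤ C) {R ε : ℝ}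
    (hR : 0 < R) (hε : 0 ≤ ε) {Good : G.Config → Prop}
    (hgood : ∀ M, G.IsDimer (D : Set V) M → Good M → ∃ m, G.GoodNear ref R ε D M m)
    (hface : ∀ M, G.IsDimer (D : Set V) M → Good M → ∀ v, G.pos v ∈ closure (G.face 0) → v ∈ D)
    (h0 : G.IsFaceOf (D : Set V) 0) (h0' : G.IsFaceOf (D' : Set V) 0)
    (hex : ∃ M, G.IsDimer (D : Set V) M) (hex' : ∃ M, G.IsDimer (D' : Set V) M) {n : ℕ}
    (hn : ∀ M M', G.IsDimer (D : Set V) M → G.IsDimer (D' : Set V) M' →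
      G.IsFaceOf ((D : Set V) ∩ D') 0 → K + n < |h' M' 0 - h M 0| →
      W ⊆ G.gapEdges D D' K h h' M M') :
    |∫ M, F M ∂(G.dimerMeasure D') - ∫ M, F M ∂(G.dimerMeasure D)| ≤
      2 * C * (∫ M, (if Good M then 0 else 1) ∂(G.dimerMeasure D) +
        (⌊4 * (K + n)⌋₊ + 1) * ε) := by
  have hZ := sum_configWeight_pos hex
  have hZ' := sum_configWeight_pos hex'
  rw [integral_dimerMeasure, integral_dimerMeasure, integral_dimerMeasure]
  set w := G.configWeight
  set Z := ∑ M ∈ G.dimers D, w M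
  set Z' := ∑ M ∈ G.dimers D', w M
  set B := ∑ M ∈ G.dimers D, w M * (if Good M then (0 : ℝ) else 1) with hB
  set c : ℝ := (⌊4 * (K + n)⌋₊ + 1) * ε
  have hw : ∀ M, 0 < w M := configWeight_pos
  have hC0 : 0 ≤ C := (abs_nonneg _).trans (hC ∅)
  -- The difference of the two means, multiplied by both partition functions, as a sum over
  -- independent pairs.
  set X := ∑ p ∈ G.dimers D ×ˢ G.dimers D', w p.1 * w p.2 * (F p.2 - F p.1) with hX
  have hXeq : X = Z * (∑ M ∈ G.dimers D', w M * F M) - (∑ M ∈ G.dimers D, w M * F M) * Z' := by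
    rw [hX, Finset.sum_mul_sum, Finset.sum_mul_sum, Finset.sum_product, ← Finset.sum_sub_distrib]
    refine Finset.sum_congr rfl fun M _ => ?_
    rw [← Finset.sum_sub_distrib]
    exact Finset.sum_congr rfl fun M' _ => by ring
  have hquot : (∑ M ∈ G.dimers D', w M * F M) / Z' - (∑ M ∈ G.dimers D, w M * F M) / Z =
      X / (Z * Z') := by
    rw [hXeq]; field_simp
  have hXle : |X| ≤ 2 * C * (B * Z' + c * Z * Z') := by
    rw [hX, ← Finset.sum_filter_add_sum_filter_not _
      (fun p => W ⊆ G.gapEdges D D' K h h' p.1 p.2), hp.sum_exchange hF, zero_add]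
    calc _ ≤ ∑ p ∈ G.dimers D ×ˢ G.dimers D' with ¬ W ⊆ G.gapEdges D D' K h h' p.1 p.2,
          |w p.1 * w p.2 * (F p.2 - F p.1)| := Finset.abs_sum_le_sum_abs _ _
      _ ≤ ∑ p ∈ G.dimers D ×ˢ G.dimers D' with ¬ W ⊆ G.gapEdges D D' K h h' p.1 p.2,
          2 * C * (w p.1 * (if Good p.1 then (0 : ℝ) else 1) * w p.2 +
          (if Good p.1 ∧ |h' p.2 0 - h p.1 0| ≤ K + n then w p.1 else 0) * w p.2) := by
          refine Finset.sum_le_sum fun p hpm => ?_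
          obtain ⟨⟨h1, h2⟩, h3⟩ : (G.IsDimer (D : Set V) p.1 ∧ G.IsDimer (D' : Set V) p.2) ∧
            ¬ W ⊆ G.gapEdges D D' K h h' p.1 p.2 := by simpa using hpm
          have h4 : |F p.2 - F p.1| ≤ 2 * C := by
            linarith [abs_sub (F p.2) (F p.1), hC p.1, hC p.2]
          have h5 : |w p.1 * w p.2 * (F p.2 - F p.1)| ≤ 2 * C * (w p.1 * w p.2) := by
            rw [abs_mul, abs_of_pos (mul_pos (hw _) (hw _)), mul_comm]
            exact mul_le_mul_of_nonneg_right h4 (mul_pos (hw _) (hw _)).le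
          by_cases hg : Good p.1
          -- A larger gap would enclose `W`. Goodness puts the vertices of the face of the origin in
          -- `D`, so that this face is one of `D ∩ D'`.
          · have h6 : |h' p.2 0 - h p.1 0| ≤ K + n := by
              by_contra hlt
              refine h3 (hn p.1 p.2 h1 h2 ?_ (not_le.1 hlt))
              obtain ⟨hs, v, hv, hvc⟩ := h0'
              exact ⟨hs, v, ⟨hface p.1 h1 hg v hvc, hv⟩, hvc⟩
            simpa [hg, h6] using h5
          · simpa [hg] using h5
      _ ≤ ∑ p ∈ G.dimers D ×ˢ G.dimers D',
          2 * C * (w p.1 * (if Good p.1 then (0 : ℝ) else 1) * w p.2 +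
          (if Good p.1 ∧ |h' p.2 0 - h p.1 0| ≤ K + n then w p.1 else 0) * w p.2) := by
          refine Finset.sum_le_sum_of_subset_of_nonneg (Finset.filter_subset _ _) fun p _ _ => ?_
          have := hw p.1
          have := hw p.2
          split_ifs <;> positivity
      _ = 2 * C * (B * Z' + ∑ M' ∈ G.dimers D', (∑ M ∈ G.dimers D,
          (if Good M ∧ |h' M' 0 - h M 0| ≤ K + n then w M else 0)) * w M') := by
          rw [← Finset.mul_sum, Finset.sum_add_distrib]
          congr 2
          · rw [Finset.sum_product, hB, Finset.sum_mul_sum]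
          · rw [Finset.sum_product_right]
            exact Finset.sum_congr rfl fun M' _ => by rw [Finset.sum_mul]
      _ ≤ 2 * C * (B * Z' + ∑ M' ∈ G.dimers D', c * Z * w M') := by
          refine mul_le_mul_of_nonneg_left (add_le_add le_rfl (Finset.sum_le_sum fun M' _ => ?_))
            (by positivity)
          -- For fixed `M'`, the number `h' M' 0` does not depend on the configuration on `D`.
          exact mul_le_mul_of_nonneg_right
            (sum_good_near_le hgood hε hp.left h0 hR (h' M' 0) (K + n)) (hw M').le
      _ = _ := by rw [← Finset.mul_sum]
  rw [hquot, abs_div, abs_of_pos (mul_pos hZ hZ'), div_le_iff₀ (mul_pos hZ hZ')]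
  refine hXle.trans_eq ?_
  field_simp

end

/-! ### Local observables -/

lemma measurableSet_of_dependsOnEdges [Countable G.Edge] {W : Set G.Edge} (hW : W.Finite)
    {A : Set G.Config} (hA : DependsOnEdges W (fun M => M ∈ A)) : MeasurableSet A := by
  have heq : A = ⋃ J ∈ {J : G.Config | J ⊆ W ∧ J ∈ A}, ⋂ e ∈ W, {M : G.Config | e ∈ M ↔ e ∈ J} := by
    ext M
    simp only [Set.mem_iUnion, Set.mem_iInter, exists_prop]
    constructor
    · intro hM
      refine ⟨M ∩ W, ⟨Set.inter_subset_right, ?_⟩, fun e he => ?_⟩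
      · exact (hA M (M ∩ W) fun e he => by simp [he]).mp hM
      · change e ∈ M ↔ e ∈ M ∩ W
        simp [he]
    · rintro ⟨J, ⟨-, hJ⟩, hMJ⟩
      exact (hA M J hMJ).mpr hJ
  rw [heq]
  refine Set.Finite.measurableSet_biUnion (hW.finite_subsets.subset fun J hJ => hJ.1) fun J _ => ?_
  refine Set.Finite.measurableSet_biInter hW fun e _ => ?_
  by_cases heJ : e ∈ J
  · simpa [heJ] using measurableSet_mem e
  · simpa [heJ] using measurableSet_notMem e

lemma measurable_of_dependsOnEdges [Countable G.Edge] {W : Set G.Edge} (hW : W.Finite)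
    {F : G.Config → ℝ} (hF : DependsOnEdges W F) : Measurable F := fun B _ =>
  measurableSet_of_dependsOnEdges hW fun M N hMN => by
    simp only [Set.mem_preimage, hF M N hMN]

variable (G) in
/-- The edges which meet the closed disc of radius `R`. -/
def edgesMeeting (R : ℝ) : Set G.Edge := {e | (G.edgeSegment e ∩ Metric.closedBall 0 R).Nonempty}

lemma localDist_le_of_agree {M N : G.Config} {R : ℝ} (hR : 0 ≤ R)
    (h : ∀ e ∈ G.edgesMeeting R, (e ∈ M ↔ e ∈ N)) : G.localDist M N ≤ Real.exp (-R) := by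
  have key : ∀ M N : G.Config, (∀ e ∈ G.edgesMeeting R, (e ∈ M ↔ e ∈ N)) →
      G.drawing M ∩ Metric.ball 0 R ⊆ G.drawing N ∩ Metric.ball 0 R := by
    rintro M N h z ⟨hz, hzR⟩
    obtain ⟨e, he, hze⟩ := Set.mem_iUnion₂.1 hz
    exact ⟨Set.mem_biUnion ((h e ⟨z, hze, Metric.ball_subset_closedBall hzR⟩).1 he) hze, hzR⟩
  refine csInf_le ⟨0, ?_⟩ ⟨R, hR, rfl, (key M N h).antisymm (key N M fun e he => (h e he).symm)⟩
  rintro _ ⟨R', -, rfl, -⟩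
  exact (Real.exp_pos _).le

/-- Configurations which are close for the local distance agree on a given finite set of edges. -/
lemma exists_localDist_agree {W : Set G.Edge} (hW : W.Finite) :
    ∃ δ > 0, ∀ M N : G.Config, G.localDist M N < δ → ∀ e ∈ W, (e ∈ M ↔ e ∈ N) := by
  induction W, hW using Set.Finite.induction_on with
  | empty => exact ⟨1, one_pos, fun _ _ _ e he => he.elim⟩
  | insert _ _ ih =>
    rename_i e W _ _
    obtain ⟨δ, hδ, H⟩ := ih
    obtain ⟨u, v, huv, rfl⟩ := G.exists_edge_eq e
    -- The midpoint is on no other edge, so it detects whether the edge is present.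
    set p := G.chart u v (1 / 2 : ℝ) with hpdef
    have hhalf : (1 / 2 : ℝ) ∈ Set.Ioo (0 : ℝ) 1 := by constructor <;> norm_num
    refine ⟨min δ (Real.exp (-‖p‖)), lt_min hδ (Real.exp_pos _), fun M N hMN => ?_⟩
    rw [lt_min_iff] at hMN
    -- The radius `0`, whose ball is empty, is always admissible; this makes the set nonempty.
    obtain ⟨_, ⟨R, hR, rfl, hdraw⟩, hlt⟩ := exists_lt_of_csInf_lt
      ⟨Real.exp (-0), by exact ⟨0, le_rfl, rfl, by simp⟩⟩ hMN.2
    have hpR : p ∈ Metric.ball (0 : ℂ) R := by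
      rw [Real.exp_lt_exp] at hlt
      simp; linarith
    have hp_mem : ∀ M : G.Config, p ∈ G.drawing M ↔ ⟨s(u, v), huv⟩ ∈ M := by
      intro M
      constructor
      · intro hpM
        obtain ⟨e, he, hpe⟩ := Set.mem_iUnion₂.1 hpM
        rwa [eq_of_chart_mem_edgeSegment huv hhalf hpe] at he
      · intro he
        refine Set.mem_biUnion he ?_
        rw [edgeSegment_mk]
        exact mem_segment_iff_chart.2 ⟨1 / 2, ⟨hhalf.1.le, hhalf.2.le⟩, rfl⟩
    rintro e (rfl | he)
    · rw [← hp_mem, ← hp_mem]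
      have := Set.ext_iff.1 hdraw p
      simpa [hpR] using this
    · exact H M N hMN.1 e he

/-- Functions which are continuous for the local distance. -/
def LocallyContinuous (F : G.Config → ℝ) : Prop :=
  ∀ M, ∀ ε > 0, ∃ δ > 0, ∀ N, G.localDist M N < δ → |F N - F M| < ε

lemma locallyContinuous_of_dependsOnEdges {W : Set G.Edge} (hW : W.Finite) {F : G.Config → ℝ}
    (hF : DependsOnEdges W F) : LocallyContinuous F := by
  intro M ε hε
  obtain ⟨δ, hδ, H⟩ := exists_localDist_agree hW
  refine ⟨δ, hδ, fun N hN => ?_⟩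
  rw [hF M N (H M N hN), sub_self, abs_zero]
  exact hε

/-- The space of configurations is compact: a continuous function is almost determined by the
edges in a large disc. -/
lemma LocallyContinuous.exists_agree {F : G.Config → ℝ} (hF : LocallyContinuous F) {η : ℝ}
    (hη : 0 < η) : ∃ k : ℕ, ∀ M N : G.Config,
      (∀ e ∈ G.edgesMeeting k, (e ∈ M ↔ e ∈ N)) → |F M - F N| < η := by
  by_contra! hcon
  choose M N hagree hge using hcon
  -- Compactness through an ultrafilter: `L` is the limit of `M k`, and also of `N k` since these
  -- agree on growing discs. Continuity at `L` gives the contradiction.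
  set U : Ultrafilter ℕ := hyperfilter ℕ
  set L : G.Config := {e | ∀ᶠ k in U, e ∈ M k} with hL
  obtain ⟨δ, hδ, H⟩ := hF L (η / 2) (by linarith)
  obtain ⟨R, hR⟩ : ∃ R : ℕ, Real.exp (-R) < δ :=
    ((Real.tendsto_exp_neg_atTop_nhds_zero.comp tendsto_natCast_atTop_atTop).eventually
      (gt_mem_nhds hδ)).exists
  have hev : ∀ᶠ k in U, ∀ e ∈ G.edgesMeeting R, (e ∈ M k ↔ e ∈ L) := by
    refine (eventually_all_finite (G.finite_edges_meeting R)).2 fun e _ => ?_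
    by_cases he : e ∈ L
    · filter_upwards [he] with k hk
      simp [hk, he]
    · filter_upwards [Ultrafilter.eventually_not.2 he] with k hk
      simp [hk, he]
  have hlarge : ∀ᶠ k in (U : Filter ℕ), R ≤ k :=
    (eventually_ge_atTop R).filter_mono Nat.hyperfilter_le_atTop
  obtain ⟨k, hk, hRk⟩ := (hev.and hlarge).exists
  have hsub : G.edgesMeeting R ⊆ G.edgesMeeting k := fun e he =>
    he.mono (Set.inter_subset_inter_right _ (Metric.closedBall_subset_closedBall (by exact_mod_cast hRk)))
  have h1 := H (M k) ((localDist_le_of_agree (Nat.cast_nonneg R)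
    fun e he => (hk e he).symm).trans_lt hR)
  have h2 := H (N k) ((localDist_le_of_agree (Nat.cast_nonneg R)
    fun e he => (hk e he).symm.trans (hagree k e (hsub he))).trans_lt hR)
  rw [abs_lt] at h1 h2
  have h3 : |F (M k) - F (N k)| < η := by rw [abs_lt]; constructor <;> linarith
  exact absurd h3 (not_lt.2 (hge k))

lemma dependsOnEdges_inter (W : Set G.Edge) (F : G.Config → ℝ) :
    DependsOnEdges W fun M => F (M ∩ W) := by
  intro M N h
  have : M ∩ W = N ∩ W := by
    ext e
    exact and_congr_left fun he => h e he
  simp only [this]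

lemma LocallyContinuous.measurable {F : G.Config → ℝ} (hF : LocallyContinuous F) :
    Measurable F := by
  have := G.countable_edge
  refine measurable_of_tendsto_metrizable (f := fun (k : ℕ) M => F (M ∩ G.edgesMeeting k))
    (fun k => measurable_of_dependsOnEdges (G.finite_edges_meeting k) (dependsOnEdges_inter _ F)) ?_
  rw [tendsto_pi_nhds]
  intro M
  rw [Metric.tendsto_atTop]
  intro η hη
  obtain ⟨k, hk⟩ := hF.exists_agree hη
  refine ⟨k, fun j hj => ?_⟩
  rw [Real.dist_eq]
  refine hk _ _ fun e he => ?_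
  have : e ∈ G.edgesMeeting j := he.mono (Set.inter_subset_inter_right _
    (Metric.closedBall_subset_closedBall (by exact_mod_cast hj)))
  simp [this]

end PlaneBipartiteGraph

namespace PlaneBipartiteGraph

variable {V : Type*} {G : PlaneBipartiteGraph V}

/-! ### Random domains -/

lemma countable_vertex (G : PlaneBipartiteGraph V) : Countable V := by
  rw [← Set.countable_univ_iff]
  refine (Set.countable_iUnion fun n : ℕ => (G.finite_vertices n).countable).mono fun v _ => ?_
  obtain ⟨n, hn⟩ := exists_nat_ge ‖G.pos v‖
  exact Set.mem_iUnion.2 ⟨n, hn⟩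

/-- There are countably many finite domains, so measurability of the events `D ω = S` suffices for
every function of the domain. -/
lemma measurable_comp_of_countable {Ω α β : Type*} [MeasurableSpace Ω] [MeasurableSpace β]
    [Countable α] {D : Ω → α} (hD : ∀ S, MeasurableSet {ω | D ω = S}) (g : α → β) :
    Measurable fun ω => g (D ω) := by
  intro B _
  have : (fun ω => g (D ω)) ⁻¹' B = ⋃ S ∈ g ⁻¹' B, {ω | D ω = S} := by
    ext ω
    simp
  rw [this]
  exact MeasurableSet.biUnion (Set.to_countable _) fun S _ => hD S

lemma isProbabilityMeasure_dimerMeasure {D : Finset V} (hex : ∃ M, G.IsDimer (D : Set V) M) :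
    IsProbabilityMeasure (G.dimerMeasure D) :=
  isProbabilityMeasure_boltzmann (G.finite_isDimer D) hex fun M => configWeight_pos M

section

variable {Ω : Type*} [MeasurableSpace Ω] {P : Measure Ω} [IsProbabilityMeasure P]
  {D : Ω → Finset V}

lemma isProbabilityMeasure_randomDimerLaw (hD : ∀ S, MeasurableSet {ω | D ω = S})
    (hex : ∀ᵐ ω ∂P, ∃ M, G.IsDimer (D ω : Set V) M) :
    IsProbabilityMeasure (G.randomDimerLaw P D) := by
  have := G.countable_vertex
  constructor
  rw [randomDimerLaw, Measure.bind_apply MeasurableSet.univ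
    (measurable_comp_of_countable hD G.dimerMeasure).aemeasurable]
  have : ∀ᵐ ω ∂P, G.dimerMeasure (D ω) Set.univ = 1 := by
    filter_upwards [hex] with ω hω
    exact (isProbabilityMeasure_dimerMeasure hω).measure_univ
  rw [lintegral_congr_ae this]
  simp

lemma integrable_of_abs_le {α : Type*} [MeasurableSpace α] {ν : Measure α} [IsProbabilityMeasure ν]
    {F : α → ℝ} (hF : Measurable F) {C : ℝ} (hC : ∀ M, |F M| ≤ C) : Integrable F ν :=
  Integrable.of_bound hF.aestronglyMeasurable C (ae_of_all _ hC)

lemma integral_randomDimerLaw (hD : ∀ S, MeasurableSet {ω | D ω = S})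
    (hex : ∀ᵐ ω ∂P, ∃ M, G.IsDimer (D ω : Set V) M) {F : G.Config → ℝ} (hF : Measurable F) {C : ℝ}
    (hC : ∀ M, |F M| ≤ C) :
    ∫ M, F M ∂(G.randomDimerLaw P D) = ∫ ω, ∫ M, F M ∂(G.dimerMeasure (D ω)) ∂P := by
  have := G.countable_vertex
  have hprob := isProbabilityMeasure_randomDimerLaw hD hex
  let κ : ProbabilityTheory.Kernel Ω G.Config :=
    ⟨fun ω => G.dimerMeasure (D ω), measurable_comp_of_countable hD G.dimerMeasure⟩
  have heq : G.randomDimerLaw P D = (κ.comp (ProbabilityTheory.Kernel.const Unit P)) () := by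
    rw [← Measure.comp_eq_comp_const_apply]
    rfl
  have hint : Integrable F (G.randomDimerLaw P D) := integrable_of_abs_le hF hC
  rw [heq] at hint ⊢
  rw [ProbabilityTheory.Kernel.integral_comp hint, ProbabilityTheory.Kernel.const_apply]
  rfl

end

lemma abs_integral_sub_le_of_abs_le {α : Type*} [MeasurableSpace α] {ν : Measure α}
    [IsProbabilityMeasure ν] {F F' : α → ℝ} (hF : Measurable F) (hF' : Measurable F') {C η : ℝ}
    (hC : ∀ M, |F M| ≤ C) (hC' : ∀ M, |F' M| ≤ C) (h : ∀ M, |F M - F' M| ≤ η) :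
    |∫ M, F M ∂ν - ∫ M, F' M ∂ν| ≤ η := by
  rw [← integral_sub (integrable_of_abs_le hF hC) (integrable_of_abs_le hF' hC')]
  have := norm_integral_le_of_norm_le_const (μ := ν) (f := fun M => F M - F' M) (ae_of_all _ h)
  simpa using this

/-! ### Spread-out configurations -/

/-- The height is constant on the face of the origin. A point of it beyond radius `R` would have
increment `0` with probability one, against the bound `ε < 1`. Thus this face is bounded. -/
lemma SpreadAt.norm_le_of_mem_face {ref : G.Edge → ℝ} {R ε : ℝ} {m : G.Config}
    (hm : G.IsDimer Set.univ m) (h : G.SpreadAt ref R ε m) (hε : ε < 1) {z : ℂ}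
    (hz : z ∈ G.face 0) : ‖z‖ ≤ R := by
  by_contra hlt
  have h1 := h z (notMem_skeleton_of_mem_face hz) (not_le.1 hlt) (-1 / 2)
  have : IsProbabilityMeasure (G.specification R m) :=
    isProbabilityMeasure_boltzmann (finite_resamplings R m) ⟨m, hm, fun _ _ => Iff.rfl⟩
      fun N => configWeight_pos (N ∩ G.edgesInside R)
  have huniv : {M : G.Config | ∀ H, G.IsHeight ref Set.univ M H →
      H 0 - H z ∈ Set.Ioo (-1 / 2 : ℝ) (-1 / 2 + 1)} = Set.univ := by
    refine Set.eq_univ_of_forall fun M H hH => ?_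
    rw [hH.1 0 z hz, sub_self]
    constructor <;> norm_num
  rw [huniv, probReal_univ] at h1
  linarith

variable (G) in
lemma exists_radius (R : ℝ) : ∃ R', R + 1 ≤ R' ∧
    ∀ e ∈ G.edgesMeeting (R + 1), ∀ v ∈ e.1, ‖G.pos v‖ ≤ R' := by
  have hfin : (⋃ e ∈ G.edgesMeeting (R + 1), {v | v ∈ e.1}).Finite := by
    refine (G.finite_edges_meeting (R + 1)).biUnion fun e _ => ?_
    obtain ⟨u, v, h, rfl⟩ := G.exists_edge_eq e
    refine (Set.toFinite {u, v}).subset fun x hx => ?_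
    simpa using hx
  obtain ⟨B, hB⟩ := (hfin.image fun v => ‖G.pos v‖).bddAbove
  exact ⟨max (R + 1) B, le_max_left _ _, fun e he v hv =>
    (hB ⟨v, Set.mem_biUnion he hv, rfl⟩).trans (le_max_right _ _)⟩

/-- `M` coincides in the disc of radius `R'` with a dimer configuration of the whole graph whose
heights are spread out. -/
def IsGood (ref : G.Edge → ℝ) (R R' ε : ℝ) (M : G.Config) : Prop :=
  ∃ m, G.IsDimer Set.univ m ∧ G.SpreadAt ref R ε m ∧ ∀ e ∈ G.edgesMeeting R', (e ∈ M ↔ e ∈ m)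

section

variable {ref : G.Edge → ℝ} {R R' ε : ℝ} {M : G.Config} {D : Set V}

/-- Spread-outness itself depends on the whole matching; asking only for a spread-out extension
gives a local event, to which measurability and local convergence apply. -/
lemma dependsOnEdges_isGood : DependsOnEdges (G.edgesMeeting R') (IsGood (G := G) ref R R' ε) := by
  have key : ∀ M N : G.Config, (∀ e ∈ G.edgesMeeting R', (e ∈ M ↔ e ∈ N)) →
      IsGood ref R R' ε M → IsGood ref R R' ε N := by
    rintro M N h ⟨m, h1, h2, h3⟩
    exact ⟨m, h1, h2, fun e he => (h e he).symm.trans (h3 e he)⟩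
  exact fun M N h => propext ⟨key M N h, key N M fun e he => (h e he).symm⟩

/-- The edge of `m` at `v` meets the disc, hence belongs to `M`, and the edges of `M` have their
ends in `D`. -/
lemma IsGood.mem_domain (hg : IsGood ref R R' ε M) (hM : G.IsDimer D M) {v : V}
    (hv : ‖G.pos v‖ ≤ R') : v ∈ D := by
  obtain ⟨m, hm, -, h⟩ := hg
  obtain ⟨e, ⟨he, hve⟩, -⟩ := hm.2 v trivial
  exact hM.1 e ((h e ⟨_, pos_mem_edgeSegment hve, by simpa using hv⟩).2 he) v hve

lemma IsGood.exists_goodNear (hg : IsGood ref R R' ε M) (hM : G.IsDimer D M) (hR' : R + 1 ≤ R')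
    (hend : ∀ e ∈ G.edgesMeeting (R + 1), ∀ v ∈ e.1, ‖G.pos v‖ ≤ R') :
    ∃ m, G.GoodNear ref R ε D M m := by
  have hmem : ∀ {v : V}, ‖G.pos v‖ ≤ R' → v ∈ D := fun hv => hg.mem_domain hM hv
  obtain ⟨m, hm, hs, h⟩ := hg
  refine ⟨m, ⟨fun v hv => hmem (hv.trans hR'), fun u v huv hne => ?_⟩, hm, hs, fun e he => ?_⟩
  · refine hmem (hend ⟨s(u, v), huv⟩ ?_ u (Sym2.mem_mk_left u v))
    rw [edgesMeeting, Set.mem_ofPred_eq, edgeSegment_mk]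
    exact hne
  · exact h e (he.mono (Set.inter_subset_inter_right _ (Metric.closedBall_subset_closedBall hR')))

lemma IsGood.mem_of_mem_closure_face (hg : IsGood ref R R' ε M) (hM : G.IsDimer D M)
    (hR' : R + 1 ≤ R') (hε : ε < 1) {v : V} (hv : G.pos v ∈ closure (G.face 0)) : v ∈ D := by
  refine hg.mem_domain hM ?_
  obtain ⟨m, hm, hs, -⟩ := hg
  have hsub : closure (G.face 0) ⊆ Metric.closedBall 0 R :=
    closure_minimal (fun z hz => by simpa using hs.norm_le_of_mem_face hm hε hz)
      Metric.isClosed_closedBall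
  have := hsub hv
  rw [mem_closedBall_zero_iff] at this
  linarith

end

/-- The dimer measures on the domains `D' n` give to local observables almost the same law as those
on the domains `D n`. -/
lemma eventually_abs_integral_sub_le (h0 : (0 : ℂ) ∉ G.skeleton) {ref : G.Edge → ℝ}
    {μ : Measure G.Config} [IsProbabilityMeasure μ] (hμ : ∀ᵐ M ∂μ, G.IsDimer Set.univ M)
    (hspread : G.SpreadOut ref μ)
    {Ω : Type*} [MeasurableSpace Ω] {P : Measure Ω} [IsProbabilityMeasure P]
    {D D' : ℕ → Ω → Finset V}
    (hDmeas : ∀ n S, MeasurableSet {ω | D n ω = S})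
    (hDmeas' : ∀ n S, MeasurableSet {ω | D' n ω = S})
    (hD : ∀ᵐ ω ∂P, ∀ n, G.IsFaceOf (D n ω : Set V) 0 ∧ ∃ M, G.IsDimer (D n ω : Set V) M)
    (hD' : ∀ᵐ ω ∂P, ∀ n, G.IsFaceOf (D' n ω : Set V) 0 ∧ ∃ M, G.IsDimer (D' n ω : Set V) M)
    (hconv : G.LocallyConverges (fun n => G.randomDimerLaw P (D n)) μ)
    {K : ℝ} (hheights : ∀ᵐ ω ∂P, ∀ n,
      G.BoundaryHeightsWithin ref (D n ω : Set V) (D' n ω : Set V) K)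
    {W : Set G.Edge} (hW : W.Finite) {F : G.Config → ℝ} (hF : DependsOnEdges W F) {C : ℝ}
    (hC : ∀ M, |F M| ≤ C) {η : ℝ} (hη : 0 < η) :
    ∀ᶠ n in atTop, |∫ M, F M ∂(G.randomDimerLaw P (D' n)) -
      ∫ M, F M ∂(G.randomDimerLaw P (D n))| ≤ η := by
  classical
  have := G.countable_edge
  have := G.countable_vertex
  have hC0 : 0 ≤ C := (abs_nonneg _).trans (hC ∅)
  have hFm : Measurable F := measurable_of_dependsOnEdges hW hF
  obtain ⟨k, hk⟩ := exists_gap_subset_gapEdges ref h0 hW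
  set c : ℝ := ⌊4 * (K + k)⌋₊ + 1 with hc
  have hc0 : 0 < c := by positivity
  -- The final bound is `2 * C * (ε + c * ε)`, with `ε` for the bad configurations and `c * ε` for a
  -- small gap. The added `1` covers `C = 0`, and `ε < 1` makes the face of the origin bounded.
  obtain ⟨ε, hε0, hε⟩ : ∃ ε : ℝ, 0 < ε ∧ ε < min 1 (η / (2 * C * (1 + c) + 1)) :=
    exists_between (by positivity)
  rw [lt_min_iff, lt_div_iff₀ (by positivity)] at hε
  obtain ⟨R, hR, hμR⟩ := hspread ε hε0
  obtain ⟨R', hR', hend⟩ := G.exists_radius R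
  have hgoodW := G.finite_edges_meeting R'
  set bad : G.Config → ℝ := fun M => if IsGood ref R R' ε M then 0 else 1 with hbad
  have hbadW : DependsOnEdges (G.edgesMeeting R') bad := by
    intro M N h
    simp only [hbad, dependsOnEdges_isGood M N h]
  have hbadm : Measurable bad := measurable_of_dependsOnEdges hgoodW hbadW
  have hbad1 : ∀ M, |bad M| ≤ 1 := by
    intro M
    simp only [hbad]
    split_ifs <;> simp
  have hμbad : ∫ M, bad M ∂μ < ε := by
    have hms : MeasurableSet {M | IsGood (G := G) ref R R' ε M} :=
      measurableSet_of_dependsOnEdges hgoodW dependsOnEdges_isGood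
    have h1 : bad = Set.indicator {M | IsGood (G := G) ref R R' ε M}ᶜ 1 := by
      funext M
      by_cases hM : IsGood ref R R' ε M <;> simp [hbad, hM]
    rw [h1, integral_indicator_one hms.compl, probReal_compl_eq_one_sub hms]
    -- The set on the left is not shown to be measurable; monotonicity of the measure is enough, as
    -- the larger set is measurable.
    have h2 : μ.real {m | G.SpreadAt ref R ε m} ≤ μ.real {M | IsGood (G := G) ref R R' ε M} := by
      refine ENNReal.toReal_mono (measure_ne_top _ _) (measure_mono_ae ?_)
      filter_upwards [hμ] with m hm hs
      exact ⟨m, hm, hs, fun _ _ => Iff.rfl⟩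
    have h3 : 1 - ε < μ.real {m | G.SpreadAt ref R ε m} := hμR
    linarith
  have hlim := hconv bad ⟨1, hbad1⟩ (locallyContinuous_of_dependsOnEdges hgoodW hbadW)
  filter_upwards [hlim.eventually (gt_mem_nhds hμbad)] with n hn
  have hex : ∀ᵐ ω ∂P, ∃ M, G.IsDimer (D n ω : Set V) M := hD.mono fun ω hω => (hω n).2
  have hex' : ∀ᵐ ω ∂P, ∃ M, G.IsDimer (D' n ω : Set V) M := hD'.mono fun ω hω => (hω n).2
  rw [integral_randomDimerLaw (hDmeas n) hex hbadm hbad1] at hn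
  rw [integral_randomDimerLaw (hDmeas n) hex hFm hC, integral_randomDimerLaw (hDmeas' n) hex' hFm hC]
  have hbound : ∀ (D : Ω → Finset V), (∀ᵐ ω ∂P, ∃ M, G.IsDimer (D ω : Set V) M) →
      (∀ S, MeasurableSet {ω | D ω = S}) → ∀ (f : G.Config → ℝ) (B : ℝ), (∀ M, |f M| ≤ B) →
      Integrable (fun ω => ∫ M, f M ∂(G.dimerMeasure (D ω))) P := by
    intro D hex hD f B hB
    refine Integrable.of_bound (measurable_comp_of_countable hD
      fun S => ∫ M, f M ∂(G.dimerMeasure S)).aestronglyMeasurable B ?_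
    filter_upwards [hex] with ω hω
    have := isProbabilityMeasure_dimerMeasure hω
    simpa using norm_integral_le_of_norm_le_const (μ := G.dimerMeasure (D ω)) (f := f)
      (ae_of_all _ hB)
  have hbadint := hbound _ hex (hDmeas n) bad 1 hbad1
  rw [← integral_sub (hbound _ hex' (hDmeas' n) F C hC) (hbound _ hex (hDmeas n) F C hC)]
  have hmain : ∀ᵐ ω ∂P, ‖∫ M, F M ∂(G.dimerMeasure (D' n ω)) - ∫ M, F M ∂(G.dimerMeasure (D n ω))‖ ≤
      2 * C * (∫ M, bad M ∂(G.dimerMeasure (D n ω)) + c * ε) := by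
    filter_upwards [hD, hD', hheights] with ω h1 h2 h3
    obtain ⟨h, h', hn, hn', hb⟩ := h3 n
    have hp : G.HeightPair ref (D n ω : Set V) (D' n ω : Set V) K h h' := ⟨hn, hn', hb⟩
    exact hp.abs_integral_sub_le hF hC hR hε0.le
      (fun M hM hg => hg.exists_goodNear hM hR' hend)
      (fun M hM hg v hv => hg.mem_of_mem_closure_face hM hR' hε.1 hv)
      (h1 n).1 (h2 n).1 (h1 n).2 (h2 n).2
      (fun M M' hM hM' hf hlt => hk _ _ K h h' M M' hp hM hM' hf hlt)
  refine (norm_integral_le_of_norm_le ((hbadint.add (integrable_const _)).const_mul _) hmain).trans ?_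
  rw [integral_const_mul, integral_add' hbadint (integrable_const _)]
  simp only [integral_const, probReal_univ, smul_eq_mul, one_mul]
  have : 2 * C * (∫ ω, ∫ M, bad M ∂(G.dimerMeasure (D n ω)) ∂P + c * ε) ≤ 2 * C * (ε + c * ε) :=
    mul_le_mul_of_nonneg_left (by linarith) (by positivity)
  nlinarith

end PlaneBipartiteGraph

theorem mainTheorem3 {V : Type*} (G : PlaneBipartiteGraph V)
    (h0 : (0 : ℂ) ∉ G.skeleton)
    (ref : G.Edge → ℝ) (href : G.IsReferenceFlow ref)
    -- the infinite volume measure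
    (μ : Measure G.Config) [IsProbabilityMeasure μ]
    (hμ : ∀ᵐ M ∂μ, G.IsDimer Set.univ M)
    (hspread : G.SpreadOut ref μ)
    -- the random domains, defined on one probability space
    {Ω : Type*} [MeasurableSpace Ω] (P : Measure Ω) [IsProbabilityMeasure P]
    (D D' : ℕ → Ω → Finset V)
    (hDmeas : ∀ n S, MeasurableSet {ω | D n ω = S})
    (hDmeas' : ∀ n S, MeasurableSet {ω | D' n ω = S})
    (hD : ∀ᵐ ω ∂P, ∀ n, G.IsFaceOf (D n ω : Set V) 0 ∧ ∃ M, G.IsDimer (D n ω : Set V) M)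
    (hD' : ∀ᵐ ω ∂P, ∀ n, G.IsFaceOf (D' n ω : Set V) 0 ∧ ∃ M, G.IsDimer (D' n ω : Set V) M)
    (hconv : G.LocallyConverges (fun n => G.randomDimerLaw P (D n)) μ)
    (K : ℝ) (hK : 0 < K)
    (hheights : ∀ᵐ ω ∂P, ∀ n,
      G.BoundaryHeightsWithin ref (D n ω : Set V) (D' n ω : Set V) K) :
    G.LocallyConverges (fun n => G.randomDimerLaw P (D' n)) μ := by
  open PlaneBipartiteGraph in
  rintro F ⟨C, hC⟩ hF
  have hFc : LocallyContinuous F := hF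
  have := G.countable_edge
  rw [Metric.tendsto_atTop]
  intro η hη
  -- Replace `F` by a function of finitely many edges: the errors are `η / 4` on each domain, `η /
  -- 8` between the domains and `η / 8` from `hconv`, less than `η` in total.
  obtain ⟨k, hk⟩ := hFc.exists_agree (η := η / 4) (by linarith)
  set W := G.edgesMeeting k
  have hW : W.Finite := G.finite_edges_meeting k
  have hFW := dependsOnEdges_inter W F
  have hFWm := measurable_of_dependsOnEdges hW hFW
  have happrox : ∀ M, |F M - F (M ∩ W)| ≤ η / 4 := fun M =>
    (hk M (M ∩ W) fun e he => by simp [W, he]).le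
  have h1 := eventually_abs_integral_sub_le h0 hμ hspread hDmeas hDmeas' hD hD' hconv hheights hW
    hFW (fun M => hC _) (η := η / 8) (by linarith)
  have h2 := (Metric.tendsto_nhds.1 (hconv F ⟨C, hC⟩ hF)) (η / 8) (by linarith)
  obtain ⟨N, hN⟩ := eventually_atTop.1 (h1.and h2)
  refine ⟨N, fun n hn => ?_⟩
  obtain ⟨h3, h4⟩ := hN n hn
  have := isProbabilityMeasure_randomDimerLaw (hDmeas n) (hD.mono fun ω hω => (hω n).2)
  have := isProbabilityMeasure_randomDimerLaw (hDmeas' n) (hD'.mono fun ω hω => (hω n).2)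
  have h5 := abs_integral_sub_le_of_abs_le (ν := G.randomDimerLaw P (D n)) hFc.measurable hFWm hC
    (fun M => hC _) happrox
  have h6 := abs_integral_sub_le_of_abs_le (ν := G.randomDimerLaw P (D' n)) hFc.measurable hFWm hC
    (fun M => hC _) happrox
  rw [Real.dist_eq] at h4 ⊢
  rw [abs_le] at h3 h5 h6
  rw [abs_lt] at h4 ⊢
  constructor <;> linarith [h3.1, h3.2, h4.1, h4.2, h5.1, h5.2, h6.1, h6.2]
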